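/- For a nonempty finite set $X\subseteq\mathbb Z$ let $\operatorname{diam}(X)=\max X-\min X$, and for nonempty finite $X,Y\subseteq\mathbb Z$ write $X<_pY$ if $\max X<\min Y$. For an integer $m\ge 2$ let $f(m,m,m;2)$ be the least integer $N$ such that for every $2$-coloring $\Delta:\{1,\dots,N\}\to\{0,1\}$ there are three sets $B_1,B_2,B_3\subseteq\{1,\dots,N\}$, each with exactly $m$ elements and each monochromatic under $\Delta$ (not necessarily of the same color), such that $B_1<_pB_2<_pB_3$ and $\operatorname{diam}(B_1)\le\operatorname{diam}(B_2)\le\operatorname{diam}(B_3)$. **Theorem.** For every integer $m\ge 2$, $$f(m,m,m;2)=8m-5+\left\lfloor\frac{2m-2}{3}\right\rfloor+\delta,$$ where $\delta=1$ if $m\in\{2,5\}$ and $\delta=0$ otherwise. -/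

import Mathlib

namespace NondecreasingDiameter

/-- The diameter `max X - min X` of a finite set of integers (with value `0` on the empty set). -/
def diam (X : Finset ℤ) : ℤ :=
  if h : X.Nonempty then X.max' h - X.min' h else 0

/-- `X <_p Y`: both sets are nonempty and `max X < min Y`. -/
def Precedes (X Y : Finset ℤ) : Prop :=
  ∃ (hX : X.Nonempty) (hY : Y.Nonempty), X.max' hX < Y.min' hY

/-- `B` is monochromatic under `Δ`: exactly one color occurs on `B`. -/
def Monochromatic {r : ℕ} (Δ : ℤ → Fin r) (B : Finset ℤ) : Prop :=
  (B.image Δ).card = 1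

/-- `B 0, …, B (t-1)` are monochromatic subsets of `[1, N]` with `|B i| = ms i`,
`B 0 <_p B 1 <_p ⋯` and `diam (B 0) ≤ diam (B 1) ≤ ⋯`. -/
structure IsSolution {t r : ℕ} (ms : Fin t → ℕ) (N : ℕ) (Δ : ℤ → Fin r)
    (B : Fin t → Finset ℤ) : Prop where
  subset : ∀ i, B i ⊆ Finset.Icc 1 (N : ℤ)
  mono : ∀ i, Monochromatic Δ (B i)
  card : ∀ i, (B i).card = ms i
  precedes : ∀ i j, i < j → Precedes (B i) (B j)
  diam_le : ∀ i j, i ≤ j → diam (B i) ≤ diam (B j)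

/-- Every `r`-coloring of `[1, N]` admits a solution. Colorings are written as functions on all
of `ℤ`; a solution lies in `[1, N]`, so only the values of `Δ` on `[1, N]` matter. -/
def Forces {t : ℕ} (ms : Fin t → ℕ) (r N : ℕ) : Prop :=
  ∀ Δ : ℤ → Fin r, ∃ B : Fin t → Finset ℤ, IsSolution ms N Δ B

/-- `IsRamseyNumber ms r N` says that `f(ms 0, …, ms (t-1); r)` exists and equals `N`: it is the
least natural number such that every `r`-coloring of `[1, N]` admits a solution. -/
def IsRamseyNumber {t : ℕ} (ms : Fin t → ℕ) (r N : ℕ) : Prop :=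
  IsLeast {n : ℕ | Forces ms r n} N

end NondecreasingDiameter

namespace NondecreasingDiameter

/-! ### Counting functions and good pairs -/

/-- `F` is a counting function: it increases by `0` or `1` at every step. The integers at which it
increases are the ones of the encoded `2`-coloring, the other integers are its zeros. -/
def IsCount (F : ℤ → ℤ) : Prop := ∀ x, F x = F (x - 1) ∨ F x = F (x - 1) + 1

/-- The integers `a` and `b` have the same color, which occurs at least `n + 1` times in
`[a, b]`. -/
def Good (n : ℤ) (F : ℤ → ℤ) (a b : ℤ) : Prop :=
  (F a = F (a - 1) + 1 ∧ F b = F (b - 1) + 1 ∧ n + 1 ≤ F b - F (a - 1)) ∨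
    (F a = F (a - 1) ∧ F b = F (b - 1) ∧ n + 1 ≤ b - F b - (a - 1 - F (a - 1)))

section Counting

variable {n : ℤ} {F : ℤ → ℤ} {a b : ℤ}

theorem IsCount.bounds (hF : IsCount F) {a b : ℤ} (hab : a ≤ b) :
    F a ≤ F b ∧ F b - F a ≤ b - a := by
  induction b, hab using Int.leInduction with
  | base => simp
  | succ k hk ih =>
    have := hF (k + 1)
    rw [add_sub_cancel_right] at this
    omega

theorem IsCount.exists_one (hF : IsCount F) {k : ℤ} (ha : F a < k) (hb : k ≤ F b) :
    ∃ p, a < p ∧ p ≤ b ∧ F p = k ∧ F (p - 1) = k - 1 := by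
  have hab : a ≤ b := by
    by_contra h
    have := hF.bounds (le_of_not_ge h)
    omega
  induction b, hab using Int.leInduction with
  | base => omega
  | succ m hm ih =>
    by_cases h : k ≤ F m
    · obtain ⟨p, h1, h2, h3⟩ := ih h
      exact ⟨p, h1, by omega, h3⟩
    · have := hF (m + 1)
      rw [add_sub_cancel_right] at this
      exact ⟨m + 1, by omega, le_rfl, by omega, by rw [add_sub_cancel_right]; omega⟩

theorem IsCount.swap (hF : IsCount F) : IsCount fun x => x - F x := fun x => by
  have := hF x
  dsimp only
  omega

theorem IsCount.exists_zero (hF : IsCount F) {k : ℤ} (ha : a - F a < k) (hb : k ≤ b - F b) :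
    ∃ p, a < p ∧ p ≤ b ∧ p - F p = k ∧ F p = F (p - 1) := by
  obtain ⟨p, h1, h2, h3, h4⟩ := hF.swap.exists_one (a := a) (b := b) ha hb
  exact ⟨p, h1, h2, h3, by omega⟩

theorem good_one {a' b' : ℤ} (ha : F a = F a' + 1) (hb : F b = F b' + 1)
    (h : n + 1 ≤ F b - F a') (ha' : a' = a - 1) (hb' : b' = b - 1) : Good n F a b := by
  subst ha' hb'
  exact Or.inl ⟨ha, hb, h⟩

theorem good_zero {a' b' : ℤ} (ha : F a = F a') (hb : F b = F b')
    (h : n + 1 ≤ b - F b - (a' - F a')) (ha' : a' = a - 1) (hb' : b' = b - 1) :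
    Good n F a b := by
  subst ha' hb'
  exact Or.inr ⟨ha, hb, h⟩

/-- Passing from `F` to `x - F x` exchanges the two colors; every later "without loss of generality"
about colors rests on this. -/
theorem good_swap : Good n (fun x => x - F x) a b ↔ Good n F a b := by
  unfold Good
  dsimp only
  constructor <;> rintro (h | h)
  · exact Or.inr (by omega)
  · exact Or.inl (by omega)
  · exact Or.inr (by omega)
  · exact Or.inl (by omega)

theorem Good.le_sub (hF : IsCount F) (hn : 0 ≤ n) (h : Good n F a b) : n ≤ b - a := by
  have hab : a ≤ b := by
    by_contra hc
    have := hF.bounds (show b ≤ a - 1 by omega)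
    rcases h with h | h <;> omega
  have := hF.bounds (show a - 1 ≤ b by omega)
  rcases h with h | h <;> omega

/-- A block of zeros `(u, v]`. -/
theorem IsCount.eq_of_le (hF : IsCount F) {u v x : ℤ} (h : F v = F u) (hu : u ≤ x) (hv : x ≤ v) :
    F x = F u := by
  have h1 := hF.bounds hu
  have h2 := hF.bounds hv
  omega

/-- A block of ones `(u, v]`. -/
theorem IsCount.eq_add_of_le (hF : IsCount F) {u v x : ℤ} (h : F v - F u = v - u) (hu : u ≤ x)
    (hv : x ≤ v) : F x = F u + (x - u) := by
  have h1 := hF.bounds hu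
  have h2 := hF.bounds hv
  omega

theorem IsCount.good_zeros (hF : IsCount F) {u v : ℤ} (h : F v = F u) (hn : 0 ≤ n) (hu : u < a)
    (hv : b ≤ v) (hab : n ≤ b - a) : Good n F a b := by
  have h1 := hF.eq_of_le h (show u ≤ a by omega) (by omega)
  have h2 := hF.eq_of_le h (show u ≤ a - 1 by omega) (by omega)
  have h3 := hF.eq_of_le h (show u ≤ b by omega) (by omega)
  have h4 := hF.eq_of_le h (show u ≤ b - 1 by omega) (by omega)
  exact Or.inr ⟨by omega, by omega, by omega⟩

theorem IsCount.good_ones (hF : IsCount F) {u v : ℤ} (h : F v - F u = v - u) (hn : 0 ≤ n)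
    (hu : u < a) (hv : b ≤ v) (hab : n ≤ b - a) : Good n F a b := by
  rw [← good_swap]
  exact hF.swap.good_zeros (u := u) (v := v) (by omega) hn hu hv hab

/-- An interval with at least `2n + 1` elements contains a good pair. -/
theorem IsCount.exists_good (hF : IsCount F) (hn : 0 ≤ n) {u v : ℤ} (h : 2 * n + 1 ≤ v - u) :
    ∃ a b, u < a ∧ b ≤ v ∧ Good n F a b := by
  rcases le_or_gt (n + 1) (F v - F u) with hc | hc
  · obtain ⟨p, h1, h2, h3, h4⟩ := hF.exists_one (a := u) (b := v) (k := F u + 1) (by omega) (by omega)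
    obtain ⟨r, h5, h6, h7, h8⟩ := hF.exists_one (a := u) (b := v) (k := F v) (by omega) (by omega)
    exact ⟨p, r, h1, h6, Or.inl ⟨by omega, by omega, by omega⟩⟩
  · obtain ⟨p, h1, h2, h3, h4⟩ :=
      hF.exists_zero (a := u) (b := v) (k := u - F u + 1) (by omega) (by omega)
    obtain ⟨r, h5, h6, h7, h8⟩ := hF.exists_zero (a := u) (b := v) (k := v - F v) (by omega) (by omega)
    exact ⟨p, r, h1, h6, Or.inr ⟨by omega, by omega, by omega⟩⟩

end Counting

/-! ### The reduced problem, and a run of zeros before a tail rich in ones -/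

/-- The coloring encoded by `F` has on `[1, L]` neither three consecutive good pairs with
nondecreasing diameters nor two consecutive good pairs with nondecreasing diameters that are at
least `2n`. -/
structure Avoids (n L : ℤ) (F : ℤ → ℤ) : Prop where
  count : IsCount F
  triple : ∀ {a₁ b₁ a₂ b₂ a₃ b₃ : ℤ}, Good n F a₁ b₁ → Good n F a₂ b₂ → Good n F a₃ b₃ →
    1 ≤ a₁ → b₁ < a₂ → b₂ < a₃ → b₃ ≤ L → b₁ - a₁ ≤ b₂ - a₂ → b₂ - a₂ ≤ b₃ - a₃ → False
  pair : ∀ {a₂ b₂ a₃ b₃ : ℤ}, Good n F a₂ b₂ → Good n F a₃ b₃ →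
    1 ≤ a₂ → b₂ < a₃ → b₃ ≤ L → 2 * n ≤ b₂ - a₂ → b₂ - a₂ ≤ b₃ - a₃ → False

theorem Avoids.swap {n L : ℤ} {F : ℤ → ℤ} (h : Avoids n L F) : Avoids n L fun x => x - F x where
  count := h.count.swap
  triple g₁ g₂ g₃ := h.triple (good_swap.1 g₁) (good_swap.1 g₂) (good_swap.1 g₃)
  pair g₂ g₃ := h.pair (good_swap.1 g₂) (good_swap.1 g₃)

/-- The final part of the coloring consists of a block `(h, g]` of zeros, preceded and followed by
a one, and a set `(g, L]` that contains at least `n + 1` ones and ends in a block `(x, L]` of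
ones. -/
structure ZeroRun (n Q L h g x : ℤ) (F : ℤ → ℤ) : Prop where
  avoids : Avoids n L F
  n_pos : 1 ≤ n
  hQ : 2 * n ≤ 3 * Q + 2
  hQn : n + 1 ≤ 2 * Q
  hL : L = 6 * n + 2 + Q
  one_h : F h = F (h - 1) + 1
  run : F g = F h
  h_lt_g : h < g
  one_g : F (g + 1) = F g + 1
  one_L : F L = F (L - 1) + 1
  card_L : n + 1 ≤ F L - F g
  zero_x : F x = F (x - 1)
  ones_x : F L - F x = L - x
  g_le_x : g ≤ x
  x_le : Q + 1 ≤ L - x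
  h_pos : 1 ≤ h
  h_le : h ≤ 3 * n + 1
  L_sub_g : L - g ≤ 3 * n
  short : ∀ {s e : ℤ}, 1 ≤ s → e ≤ h - 1 → Good n F s e → e - s < 2 * n

namespace ZeroRun

variable {n Q L h g x : ℤ} {F : ℤ → ℤ}

theorem good_last (H : ZeroRun n Q L h g x F) : Good n F (g + 1) L :=
  good_one H.one_g H.one_L H.card_L (by ring) rfl

theorem L_sub_g_gt (H : ZeroRun n Q L h g x F) : n + 1 ≤ L - g := by
  have := H.good_last.le_sub H.avoids.count (by have := H.n_pos; omega)
  omega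

/-- A run of 2n + 2 zeros would split into two good pairs of diameter n, and `good_last` would
complete a triple. -/
theorem run_le (H : ZeroRun n Q L h g x F) : g - h ≤ 2 * n + 1 := by
  by_contra hc
  have := H.n_pos
  have := H.h_pos
  have := H.L_sub_g_gt
  exact H.avoids.triple
    (H.avoids.count.good_zeros (a := h + 1) (b := h + n + 1) H.run (by omega) (by omega)
      (by omega) (by omega))
    (H.avoids.count.good_zeros (a := h + n + 2) (b := h + 2 * n + 2) H.run (by omega) (by omega)
      (by omega) (by omega))
    H.good_last (by omega) (by omega) (by omega) (by omega) (by omega) (by omega)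

/-- A pair violating this could be followed by a zero pair of the same diameter at the start of the
run, and then by `good_last`. -/
theorem min_le (H : ZeroRun n Q L h g x F) {s e : ℤ} (hs : 1 ≤ s) (he : e ≤ h)
    (hg : Good n F s e) : g - h ≤ e - s ∨ L - g ≤ e - s := by
  by_contra! hc
  have := H.n_pos
  have := hg.le_sub H.avoids.count (by omega)
  exact H.avoids.triple hg
    (H.avoids.count.good_zeros (a := h + 1) (b := h + 1 + (e - s)) H.run (by omega) (by omega)
      (by omega) (by omega))
    H.good_last (by omega) (by omega) (by omega) (by omega) (by omega) (by omega)

theorem le_of_long (H : ZeroRun n Q L h g x F) {s e : ℤ} (hs : 1 ≤ s) (he : e ≤ g)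
    (hg : Good n F s e) (hd : 2 * n ≤ e - s) : L - g ≤ e - s := by
  by_contra! hc
  exact H.avoids.pair hg H.good_last hs (by omega) le_rfl hd (by omega)

/-- The number of ones in an interval in which good pairs of ones have diameter at least `k` and
at most `2n - 1`. -/
theorem _root_.NondecreasingDiameter.IsCount.card_ones_le (hF : IsCount F) {u v k : ℤ}
    (h₁ : ∀ a b, u < a → b ≤ v → Good n F a b → k ≤ b - a)
    (h₂ : ∀ a b, u < a → b ≤ v → Good n F a b → b - a < 2 * n) (hn : 0 ≤ n) :
    F v - F u ≤ n ∨ F v - F u ≤ 3 * n - k := by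
  by_contra! hc
  obtain ⟨p, hp1, hp2, hp3, hp4⟩ := hF.exists_one (a := u) (b := v) (k := F u + 1) (by omega)
    (by omega)
  obtain ⟨r, hr1, hr2, hr3, hr4⟩ := hF.exists_one (a := u) (b := v) (k := F u + n + 1) (by omega)
    (by omega)
  obtain ⟨s, hs1, hs2, hs3, hs4⟩ := hF.exists_one (a := u) (b := v) (k := F v) (by omega)
    (by omega)
  -- The first n + 1 ones already span at least k, each further one costs a position, and all of
  -- them together span less than 2n.
  have g₁ : Good n F p r := Or.inl ⟨by omega, by omega, by omega⟩
  have g₂ : Good n F p s := Or.inl ⟨by omega, by omega, by omega⟩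
  have d₁ := h₁ p r hp1 hr2 g₁
  have d₂ := h₂ p s hp1 hs2 g₂
  have hrs : r ≤ s := by
    by_contra hc
    have := hF.bounds (show s ≤ r - 1 by omega)
    omega
  have := hF.bounds hrs
  omega

/-- Since the run and the end are both short, `min_le` bounds the diameters of good pairs before h
from below, while `short` bounds them by 2n. So each color is rare in [1, h - 1], too rare to fill
it. -/
theorem false_of_short_end (H : ZeroRun n Q L h g x F) (hB : L - g ≤ 2 * n) : False := by
  have hF := H.avoids.count
  have a_le := H.run_le
  have ⟨_, hn, hQ, hQn, hL, _, _, _, _, _, _, _, _, _, _, hh, h_le, _, short⟩ := H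
  have key₁ : ∀ a b, 0 < a → b ≤ h - 1 → Good n F a b → L - h - 2 * n - 1 ≤ b - a := by
    intro a b ha hb hg
    rcases H.min_le (by omega) (by omega) hg with h1 | h1 <;> omega
  have key₂ : ∀ a b, 0 < a → b ≤ h - 1 → Good n F a b → b - a < 2 * n :=
    fun a b ha hb hg => short (by omega) hb hg
  have c₁ := hF.card_ones_le key₁ key₂ (by omega)
  have c₂ := hF.swap.card_ones_le (u := 0) (v := h - 1) (n := n) (k := L - h - 2 * n - 1)
    (fun a b ha hb hg => key₁ a b ha hb (good_swap.1 hg))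
    (fun a b ha hb hg => key₂ a b ha hb (good_swap.1 hg)) (by omega)
  omega

/-- A zero `t` before the run either has few zeros after it, or it is far from `h`. -/
theorem far_of_zero (H : ZeroRun n Q L h g x F) (hB : 2 * n + 1 ≤ L - g) {t : ℤ} (ht : 1 ≤ t)
    (htg : t ≤ g - 2 * n) (h0 : F t = F (t - 1))
    (hc : n + 1 ≤ g - F g - (t - 1 - F (t - 1))) :
    L - g - n ≤ F h - F t ∨ (L - g ≤ h + 1 - t ∧ n + 1 ≤ h - F h - (t - 1 - F (t - 1))) := by
  have hF := H.avoids.count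
  have hn := H.n_pos
  have hr := H.run
  have hgt := H.h_lt_g
  have good : ∀ e, h < e → e ≤ g → n + 1 ≤ e - F h - (t - 1 - F (t - 1)) → Good n F t e := by
    intro e he1 he2 he3
    have e1 := hF.eq_of_le hr (show h ≤ e by omega) he2
    have e2 := hF.eq_of_le hr (show h ≤ e - 1 by omega) (by omega)
    exact Or.inr ⟨h0, by omega, by omega⟩
  have long : ∀ e, h < e → e ≤ g → n + 1 ≤ e - F h - (t - 1 - F (t - 1)) → L - g ≤ e - t := by
    intro e he1 he2 he3
    refine H.le_of_long ht he2 (good e he1 he2 he3) ?_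
    -- A diameter below 2n can be increased to exactly 2n inside the run because t ≤ g - 2n; then
    -- `le_of_long` would give L - g ≤ 2n.
    by_contra hlt
    have := H.le_of_long ht (by omega) (good (t + 2 * n) (by omega) (by omega) (by omega))
      (by omega)
    omega
  -- The shortest good pair that starts at t and ends in the run ends at h + 1 or at the zero that
  -- completes n + 1 zeros.
  by_cases h1 : n + 1 ≤ h + 1 - F h - (t - 1 - F (t - 1))
  · have := long (h + 1) (by omega) (by omega) h1
    omega
  · have := long (n + 1 + F h + (t - 1 - F (t - 1))) (by omega) (by omega) (by omega)
    omega

end ZeroRun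

/-! ### Long ends: the coloring before the run -/

namespace ZeroRun

variable {n Q L h g x : ℤ} {F : ℤ → ℤ}

/-- A block of at least `n + 1` ones in `[1, h]` is followed by the run of zeros. -/
theorem false_of_ones (H : ZeroRun n Q L h g x F) (ha : n + 1 ≤ g - h) {u v : ℤ} (hu : 0 ≤ u)
    (hv : v ≤ h) (h1 : F v - F u = v - u) (huv : n + 1 ≤ v - u) : False := by
  have hF := H.avoids.count
  have hn := H.n_pos
  have := H.L_sub_g_gt
  rcases H.min_le (s := u + 1) (e := u + n + 1) (by omega) (by omega)
    (hF.good_ones h1 (by omega) (by omega) (by omega) (by omega)) with h2 | h2 <;> omega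

theorem le_h (H : ZeroRun n Q L h g x F) (hB : 2 * n + 1 ≤ L - g) : 2 * n + 1 ≤ h := by
  by_contra! hc
  have hF := H.avoids.count
  have hmin := H.run_le
  have ⟨_, hn, hQ, hQn, hL, one_h, run, hgt, _, _, _, _, _, _, _, hh, h_le, hB3, short⟩ := H
  -- The bound on u defeats the first alternative of `far_of_zero` and the bound on v makes that
  -- lemma applicable, so (u, v] contains no zero.
  obtain ⟨u, v, hu, hv, huv, hu1, hu2⟩ : ∃ u v, 0 ≤ u ∧ v ≤ h ∧ n + 1 ≤ v - u ∧
      h - (L - g) + n ≤ u ∧ v ≤ g - 2 * n := by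
    rcases le_total 0 (h - (L - g) + n) with h1 | h1 <;>
    rcases le_total h (g - 2 * n) with h2 | h2
    · exact ⟨_, _, h1, le_rfl, by omega, le_rfl, h2⟩
    · exact ⟨_, _, h1, h2, by omega, le_rfl, le_rfl⟩
    · exact ⟨_, _, le_rfl, le_rfl, by omega, h1, h2⟩
    · exact ⟨_, _, le_rfl, h2, by omega, h1, le_rfl⟩
  have := hF.bounds (show u ≤ v by omega)
  refine H.false_of_ones (by omega) hu hv ?_ huv
  by_contra hne
  obtain ⟨t, ht1, ht2, ht3, ht4⟩ := hF.exists_zero (a := u) (b := v) (k := v - F v) (by omega)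
    (by omega)
  have := hF.bounds (show t - 1 ≤ h by omega)
  have := hF.bounds (show t ≤ h by omega)
  rcases H.far_of_zero hB (by omega) (by omega) ht4 (by omega) with h1 | h1 <;> omega

/-- There are at least `n + 1` ones among the last `2n` elements of `[1, h]`. -/
theorem card_window (H : ZeroRun n Q L h g x F) (hB : 2 * n + 1 ≤ L - g) :
    n + 1 ≤ F h - F (h - 2 * n) := by
  by_contra! hc
  have hF := H.avoids.count
  have hle := H.le_h hB
  have hmin := H.run_le
  have ⟨_, hn, hQ, hQn, hL, one_h, run, hgt, _, _, _, _, _, _, _, hh, h_le, hB3, short⟩ := H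
  -- Beyond lo, a position is too close to h to start a good pair of diameter L - g that ends at h
  -- or h + 1.
  obtain ⟨lo, hlo, hlo1, hlo2⟩ : ∃ lo, 0 ≤ lo ∧ h + 1 - (L - g) ≤ lo ∧
      (lo = 0 ∨ lo = h + 1 - (L - g)) := by
    rcases le_total 0 (h + 1 - (L - g)) with h1 | h1
    · exact ⟨_, h1, le_rfl, Or.inr rfl⟩
    · exact ⟨_, le_rfl, h1, Or.inl rfl⟩
  have ones_le : F h - F lo ≤ n := by
    by_contra! h1
    obtain ⟨p, hp1, hp2, hp3, hp4⟩ := hF.exists_one (a := lo) (b := h) (k := F h - n) (by omega)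
      (by omega)
    have hp : p ≤ h - 2 * n := by
      by_contra! h2
      have := hF.bounds (show h - 2 * n ≤ p - 1 by omega)
      omega
    have := H.le_of_long (s := p) (e := h) (by omega) (by omega)
      (Or.inl ⟨by omega, one_h, by omega⟩) (by omega)
    omega
  have poor : ∀ t, lo < t → t ≤ h → t ≤ g - 2 * n → F t = F (t - 1) →
      g - F g - (t - 1 - F (t - 1)) ≤ n := by
    intro t h1 h2 h3 h4
    by_contra! h5
    have := hF.bounds (show lo ≤ t by omega)
    rcases H.far_of_zero hB (by omega) h3 h4 (by omega) with h6 | h6 <;> omega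
  obtain ⟨v, hv, hv1, hv2⟩ : ∃ v, v ≤ h ∧ v ≤ g - 2 * n ∧ (v = h ∨ v = g - 2 * n) := by
    rcases le_total h (g - 2 * n) with h2 | h2
    · exact ⟨_, le_rfl, h2, Or.inl rfl⟩
    · exact ⟨_, h2, le_rfl, Or.inr rfl⟩
  have hlv : lo + n + 1 ≤ v := by omega
  by_cases h1 : F v - F lo = v - lo
  · have := hF.bounds hv
    omega
  · have := hF.bounds (show lo ≤ v by omega)
    obtain ⟨t, ht1, ht2, ht3, ht4⟩ := hF.exists_zero (a := lo) (b := v) (k := lo - F lo + 1)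
      (by omega) (by omega)
    have := poor t ht1 (by omega) (by omega) ht4
    omega

/-- By `card_window` the pair (p, h) is good; being of diameter at least 2n, it must reach diameter
L - g. Hence the positions between h - (L - g) and h - 2n are zeros. -/
theorem zero_of_window (H : ZeroRun n Q L h g x F) (hB : 2 * n + 1 ≤ L - g) {p : ℤ}
    (hp : 1 ≤ p) (hp2 : p ≤ h - 2 * n) (h1 : F p = F (p - 1) + 1) : p ≤ h - (L - g) := by
  have hF := H.avoids.count
  have := H.card_window hB
  have := hF.bounds (show p ≤ h - 2 * n by omega)
  have := H.le_of_long (s := p) (e := h) (by omega) (by have := H.h_lt_g; omega)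
    (Or.inl ⟨by omega, H.one_h, by omega⟩) (by omega)
  omega

theorem zero_at_window (H : ZeroRun n Q L h g x F) (hB : 2 * n + 1 ≤ L - g) :
    F (h - 2 * n) = F (h - 2 * n - 1) := by
  have := H.le_h hB
  rcases H.avoids.count (h - 2 * n) with h1 | h1
  · exact h1
  · have := H.zero_of_window hB (by omega) le_rfl h1
    omega

/-- If there are few zeros immediately before `h`, then `[1, h - 2n]` consists of zeros. -/
theorem zeros_start (H : ZeroRun n Q L h g x F) (hB : 2 * n + 1 ≤ L - g) {t : ℤ}
    (hth : F t + 2 ≤ F h) (hz : 2 * n + 1 + (h - F h - (t - F t)) ≤ L - g) :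
    F (h - 2 * n) = F 0 := by
  have hF := H.avoids.count
  have hle := H.le_h hB
  have hone := H.one_h
  have hn := H.n_pos
  have := H.card_window hB
  by_contra hne
  have := hF.bounds (show 0 ≤ h - 2 * n by omega)
  obtain ⟨p, hp1, hp2, hp3, hp4⟩ := hF.exists_one (a := 0) (b := h - 2 * n) (k := F 0 + 1)
    (by omega) (by omega)
  have h1 := H.zero_of_window hB (by omega) hp2 (by omega)
  obtain ⟨r, hr1, hr2, hr3, hr4⟩ := hF.exists_one (a := t) (b := h - 1) (k := F (h - 1))
    (by omega) (by omega)
  have := H.short (s := p) (e := r) (by omega) hr2 (Or.inl ⟨by omega, by omega, by omega⟩)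
  have := hF.bounds (show t ≤ r by omega)
  omega

end ZeroRun

/-! ### Short runs -/

namespace ZeroRun

variable {n Q L h g x : ℤ} {F : ℤ → ℤ}

/-- The position h - 2n is a zero, so either few zeros lie between it and g, or `far_of_zero` forces
many ones into the window before h. -/
theorem few_zeros (H : ZeroRun n Q L h g x F) (hB : 2 * n + 1 ≤ L - g) (ha : g - h ≤ n) :
    2 * n - (F h - F (h - 2 * n)) ≤ n - 1 - Q - (3 * n + 1 - h) := by
  have hF := H.avoids.count
  have hle := H.le_h hB
  have hw := H.card_window hB
  have h0 := H.zero_at_window hB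
  have ⟨_, hn, hQ, hQn, hL, one_h, run, hgt, _, _, _, _, _, _, _, hh, h_le, hB3, short⟩ := H
  by_cases hc : n + 1 ≤ g - F g - (h - 2 * n - 1 - F (h - 2 * n - 1))
  · rcases H.far_of_zero hB (by omega) (by omega) h0 hc with h1 | h1 <;> omega
  · omega

/-- A good pair of ones with diameter `h - s` close to `n`, ending at `h`. -/
theorem exists_last_ones (H : ZeroRun n Q L h g x F) {t : ℤ} (ht : F t + n + 1 ≤ F h) :
    ∃ s, t < s ∧ Good n F s h ∧ h - s ≤ n + (h - F h - (t - F t)) ∧ n ≤ h - s := by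
  have hF := H.avoids.count
  have hn := H.n_pos
  obtain ⟨s, hs1, hs2, hs3, hs4⟩ := hF.exists_one (a := t) (b := h) (k := F h - n) (by omega)
    (by omega)
  have hg : Good n F s h := Or.inl ⟨by omega, H.one_h, by omega⟩
  have := hF.bounds (show t ≤ s - 1 by omega)
  exact ⟨s, hs1, hg, by omega, hg.le_sub hF (by omega)⟩

/-- If h = 3n + 1, the initial zeros would hold a pair of diameter n, followed by the pair of ones
ending at h and by `good_last`. -/
theorem lt_of_short_run (H : ZeroRun n Q L h g x F) (hB : 2 * n + 1 ≤ L - g) (ha : g - h ≤ n) :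
    F (h - 2 * n) = F 0 ∧ h ≤ 3 * n := by
  have hF := H.avoids.count
  have hle := H.le_h hB
  have hw := H.card_window hB
  have hz := H.few_zeros hB ha
  have h0 := H.zeros_start hB (t := h - 2 * n) (by have := H.n_pos; omega)
    (by have ⟨_, hn, hQ, hQn, hL, one_h, run, hgt, _, _, _, _, _, _, _, hh, h_le, hB3, short⟩ := H
        omega)
  refine ⟨h0, ?_⟩
  have ⟨_, hn, hQ, hQn, hL, one_h, run, hgt, _, _, _, _, _, _, _, hh, h_le, hB3, short⟩ := H
  by_contra! hc
  obtain ⟨s, hs1, hs2, hs3, hs4⟩ := H.exists_last_ones (t := h - 2 * n) (by omega)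
  exact H.avoids.triple (hF.good_zeros (a := 1) (b := n + 1) h0 (by omega) (by omega) (by omega)
    (by omega)) hs2 H.good_last le_rfl (by omega) (by omega) le_rfl (by omega) (by omega)

/-- A good pair of ones of diameter about `2n` that ends immediately after the run. -/
theorem exists_long_ones (H : ZeroRun n Q L h g x F) (hB : 2 * n + 1 ≤ L - g) (ha : g - h ≤ n) :
    ∃ p, 1 ≤ p ∧ Good n F p (g + 1) ∧ 2 * n ≤ g + 1 - p ∧
      g + 1 - p ≤ 4 * n - (F h - F (h - 2 * n)) := by
  have hF := H.avoids.count
  have hle := H.le_h hB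
  have hw := H.card_window hB
  have hz := H.few_zeros hB ha
  have ⟨_, hn, hQ, hQn, hL, one_h, run, hgt, one_g, _, _, _, _, _, _, hh, h_le, hB3, short⟩ := H
  have b1 := hF.bounds (show h - 2 * n ≤ g + 1 - 2 * n by omega)
  have b2 := hF.bounds (show g + 1 - 2 * n ≤ h by omega)
  -- The start p is the latest one that leaves both diameter at least 2n and n + 1 ones up to g + 1.
  obtain ⟨k, hk1, hk2, hk3⟩ : ∃ k, k ≤ F (g + 1 - 2 * n) ∧ k ≤ F h - n + 1 ∧
      (k = F (g + 1 - 2 * n) ∨ k = F h - n + 1) := by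
    rcases le_total (F (g + 1 - 2 * n)) (F h - n + 1) with h2 | h2
    · exact ⟨_, le_rfl, h2, Or.inl rfl⟩
    · exact ⟨_, h2, le_rfl, Or.inr rfl⟩
  obtain ⟨p, hp1, hp2, hp3, hp4⟩ := hF.exists_one (a := h - 2 * n) (b := g + 1 - 2 * n) (k := k)
    (by omega) hk1
  have b3 := hF.bounds (show h - 2 * n ≤ p by omega)
  have b4 := hF.bounds (show p ≤ h by omega)
  exact ⟨p, by omega, good_one (a' := p - 1) (b' := g) (by omega) one_g (by omega) rfl (by ring),
    by omega, by omega⟩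

/-- The second one y after the run still starts a good pair ending at L. Comparison with the long
pair ending at g + 1 pushes y far to the right, so apart from g + 1 everything between h and y is
zero. That stretch supplies the missing zero pairs. -/
theorem false_of_short_run_of_many_ones (H : ZeroRun n Q L h g x F) (hB : 2 * n + 1 ≤ L - g)
    (ha : g - h ≤ n) (hT : n + 2 ≤ F L - F g) : False := by
  have hF := H.avoids.count
  have hle := H.le_h hB
  have hw := H.card_window hB
  have hz := H.few_zeros hB ha
  have hh3 := (H.lt_of_short_run hB ha).2
  obtain ⟨p, hp0, hp1, hp2, hp3⟩ := H.exists_long_ones hB ha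
  obtain ⟨s, hs1, hs2, hs3, hs4⟩ := H.exists_last_ones (t := h - 2 * n) (by omega)
  have ⟨_, hn, hQ, hQn, hL, one_h, run, hgt, one_g, one_L, _, _, _, _, _, hh, h_le, hB3, short⟩ := H
  have avoid := H.avoids
  obtain ⟨y, hy1, hy2, hy3, hy4⟩ := hF.exists_one (a := g + 1) (b := L) (k := F g + 2) (by omega)
    (by omega)
  have good_y : Good n F y L := Or.inl ⟨by omega, one_L, by omega⟩
  have dy := good_y.le_sub hF (by omega)
  have hy5 : L - y < g + 1 - p := by
    by_contra! hc
    exact avoid.pair hp1 good_y hp0 (by omega) le_rfl hp2 hc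
  have zeros₁ : ∀ v, h ≤ v → v ≤ g → F v = F h := fun v h1 h2 => hF.eq_of_le run h1 h2
  have zeros₂ : ∀ v, g + 1 ≤ v → v ≤ y - 1 → F v = F h + 1 := fun v h1 h2 => by
    have := hF.eq_of_le (show F (y - 1) = F (g + 1) by omega) h1 h2
    omega
  have good₁ : ∀ b, g + 1 < b → b < y → n + 1 ≤ b - h - 1 → Good n F (h + 1) b := by
    intro b h1 h2 h3
    have e1 := zeros₁ (h + 1) (by omega) (by omega)
    have e2 := zeros₂ b (by omega) (by omega)
    have e3 := zeros₂ (b - 1) (by omega) (by omega)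
    exact good_zero (a' := h) (b' := b - 1) e1 (by omega) (by omega) (by ring) rfl
  have good₂ : ∀ a b, g + 1 < a → b < y → n ≤ b - a → Good n F a b := by
    intro a b h1 h2 h3
    exact hF.good_zeros (u := g + 1) (v := y - 1) (by omega) (by omega) (by omega) (by omega) h3
  -- A zero pair starting at h + 1 and passing over the one at g + 1 needs diameter n + 1 to be
  -- good, and h - s to follow (s, h).
  obtain ⟨D, hD1, hD2, hD3⟩ : ∃ D, h - s ≤ D ∧ n + 1 ≤ D ∧ (D = h - s ∨ D = n + 1) := by
    rcases le_total (h - s) (n + 1) with h2 | h2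
    · exact ⟨_, h2, le_rfl, Or.inr rfl⟩
    · exact ⟨_, le_rfl, h2, Or.inl rfl⟩
  have hy6 : L - y < D := by
    by_contra! hc
    exact avoid.triple hs2 (good₁ (h + 1 + D) (by omega) (by omega) (by omega)) good_y
      (by omega) (by omega) (by omega) le_rfl (by omega) (by omega)
  by_cases hy7 : n + 1 ≤ L - y
  · exact avoid.triple (good₁ (h + n + 2) (by omega) (by omega) (by omega))
      (good₂ (h + n + 3) (h + 2 * n + 4) (by omega) (by omega) (by omega)) good_y
      (by omega) (by omega) (by omega) le_rfl (by omega) (by omega)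
  · exact avoid.triple hs2 (good₁ (h + 1 + D) (by omega) (by omega) (by omega))
      (good₂ (h + 2 + D) (y - 1) (by omega) (by omega) (by omega))
      (by omega) (by omega) (by omega) (by omega) (by omega) (by omega)

end ZeroRun

namespace ZeroRun

variable {n Q L h g x : ℤ} {F : ℤ → ℤ}

/-- The end has exactly n + 1 ones, at least Q + 1 of them in its final block, so few ones interrupt
the zeros up to x. Two zero pairs there follow (s, h). -/
theorem false_of_short_run_of_few_ones (H : ZeroRun n Q L h g x F) (hB : 2 * n + 1 ≤ L - g)
    (ha : g - h ≤ n) (hT : F L - F g ≤ n + 1) : False := by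
  have hF := H.avoids.count
  have hle := H.le_h hB
  have hw := H.card_window hB
  have hz := H.few_zeros hB ha
  have hh3 := (H.lt_of_short_run hB ha).2
  obtain ⟨s, hs1, hs2, hs3, hs4⟩ := H.exists_last_ones (t := h - 2 * n) (by omega)
  have ⟨_, hn, hQ, hQn, hL, one_h, run, hgt, one_g, one_L, _, zero_x, _, _, _, hh, h_le, hB3,
    short⟩ := H
  -- The second pair ends at the j-th zero after h: late enough for n + 1 zeros and for diameter h -
  -- s. The shift r below removes what is superfluous at its start.
  obtain ⟨j, hj1, hj2, hj3⟩ : ∃ j, n + 1 ≤ j ∧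
      h + (h - s) - F (h + (h - s)) - (h - F h) + 1 ≤ j ∧
      (j = n + 1 ∨ n + 2 ≤ j ∧ j = h + (h - s) - F (h + (h - s)) - (h - F h) + 1) := by
    rcases le_or_gt (h + (h - s) - F (h + (h - s)) - (h - F h) + 1) (n + 1) with h2 | h2
    · exact ⟨_, le_rfl, h2, Or.inl rfl⟩
    · exact ⟨_, h2.le, le_rfl, Or.inr ⟨by omega, rfl⟩⟩
  have hj4 : j = n + 1 ∨ j ≤ h - s := by
    rcases hj3 with h1 | ⟨h1, h2⟩
    · exact Or.inl h1
    · have b1 := hF.bounds (show h ≤ h + (h - s) by omega)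
      have : g < h + (h - s) := by
        by_contra! hc
        have := hF.bounds hc
        omega
      have := hF.bounds (show g + 1 ≤ h + (h - s) by omega)
      exact Or.inr (by omega)
  obtain ⟨u, hu1, hu2, hu3, hu4⟩ := hF.exists_zero (a := h) (b := x) (k := h - F h + j) (by omega)
    (by omega)
  obtain ⟨w, hw1, hw2, hw3, hw4⟩ := hF.exists_zero (a := h) (b := x) (k := h - F h + j + 1)
    (by omega) (by omega)
  have huw : u < w := by
    by_contra! hc
    have := hF.bounds hc
    omega
  have hu5 : h + 1 + (h - s) ≤ u := by
    by_contra! hc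
    have := hF.bounds (show u ≤ h + (h - s) by omega)
    omega
  have b1 := hF.bounds (show h ≤ u by omega)
  have b2 := hF.bounds huw.le
  have b3 := hF.bounds hw2
  obtain ⟨r, hr0, hr1, hr2, hr3⟩ : ∃ r, 0 ≤ r ∧ r ≤ j - n - 1 ∧ r ≤ u - h - 1 - (h - s) ∧
      (r = j - n - 1 ∨ r = u - h - 1 - (h - s)) := by
    rcases le_total (j - n - 1) (u - h - 1 - (h - s)) with h2 | h2
    · exact ⟨_, by omega, le_rfl, h2, Or.inl rfl⟩
    · exact ⟨_, by omega, h2, le_rfl, Or.inr rfl⟩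
  have hr4 : h + 1 + r ≤ g := by omega
  have e1 := hF.eq_of_le run (show h ≤ h + 1 + r by omega) hr4
  have e2 := hF.eq_of_le run (show h ≤ h + r by omega) (by omega)
  refine H.avoids.triple hs2
    (good_zero (a := h + 1 + r) (b := u) (a' := h + r) (b' := u - 1) (by omega) (by omega)
      (by omega) (by ring) rfl)
    (good_zero (a := w) (b := x) (a' := w - 1) (b' := x - 1) (by omega) (by omega) (by omega) rfl
      rfl) (by omega) (by omega) (by omega) (by omega) (by omega) ?_
  by_contra! hc
  clear hj3 hw hs1
  have key : L - h ≤ j + (u - h - 1 - r) + n + 1 := by omega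
  have key' : F u - F h ≤ n - Q := by omega
  clear hc
  rcases hr3 with hr3 | hr3 <;> rcases hj4 with hj4 | hj4 <;> omega

/-! ### Long runs -/

/-- The properties of the last zero `t` with distance at least `2n` from the end of the run, in
the case of a long run. -/
theorem exists_last_far_zero (H : ZeroRun n Q L h g x F) (hB : 2 * n + 1 ≤ L - g)
    (ha : n + 1 ≤ g - h) : ∃ t, h - 2 * n ≤ t ∧ t ≤ g - 2 * n ∧ t ≤ h - 1 ∧ F t = F (t - 1) ∧
      L - g - n ≤ F h - F t ∧ g - h < 2 * n ∧ F (g - 2 * n) - F t = g - 2 * n - t := by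
  have hF := H.avoids.count
  have hle := H.le_h hB
  have hw := H.card_window hB
  have h0 := H.zero_at_window hB
  have ⟨_, hn, hQ, hQn, hL, one_h, run, hgt, one_g, one_L, _, zero_x, _, _, _, hh, h_le, hB3,
    short⟩ := H
  obtain ⟨v, hv, hv1, hv2⟩ : ∃ v, v ≤ h ∧ v ≤ g - 2 * n ∧ (v = h ∨ v = g - 2 * n) := by
    rcases le_total h (g - 2 * n) with h2 | h2
    · exact ⟨_, le_rfl, h2, Or.inl rfl⟩
    · exact ⟨_, h2, le_rfl, Or.inr rfl⟩
  have b1 := hF.bounds (show h - 2 * n ≤ v by omega)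
  obtain ⟨t, ht1, ht2, ht3, ht4⟩ := hF.exists_zero (a := h - 2 * n - 1) (b := v) (k := v - F v)
    (by omega) (by omega)
  have b2 := hF.bounds (show h - 2 * n - 1 ≤ t - 1 by omega)
  have hth : t ≤ h - 1 := by
    by_contra! hc
    have : t = h := by omega
    subst this
    omega
  have hfar : L - g - n ≤ F h - F t := by
    have b3 := hF.bounds (show t - 1 ≤ h by omega)
    rcases H.far_of_zero hB (by omega) (by omega) ht4 (by omega) with h1 | h1
    · exact h1
    · have : t = h - 2 * n := by omega
      subst this
      omega
  have hgh : g - h < 2 * n := by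
    by_contra! hc
    have : v = h := by omega
    subst this
    exact H.false_of_ones ha (u := t) (by omega) le_rfl (by omega) (by omega)
  have : v = g - 2 * n := by omega
  subst this
  exact ⟨t, by omega, ht2, hth, ht4, hfar, hgh, by omega⟩

/-- The zero t replaces h - 2n as reference point. By `min_le` the pair (s, h) is at least as long
as the run, so the next zero pair again extends past g; the split into many or few ones at the end
is as for short runs. -/
theorem false_of_long_run (H : ZeroRun n Q L h g x F) (hB : 2 * n + 1 ≤ L - g)
    (ha : n + 1 ≤ g - h) : False := by
  have hF := H.avoids.count
  have hle := H.le_h hB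
  have hw := H.card_window hB
  have h0 := H.zero_at_window hB
  obtain ⟨t, ht1, ht2, ht3, ht4, ht5, ht6, ht7⟩ := H.exists_last_far_zero hB ha
  obtain ⟨s, hs1, hs2, hs3, hs4⟩ := H.exists_last_ones (t := t) (by omega)
  have ⟨_, hn, hQ, hQn, hL, one_h, run, hgt, one_g, one_L, _, zero_x, ones_x, _, _, hh, h_le, hB3,
    short⟩ := H
  have avoid := H.avoids
  have hs5 : h - s < 2 * n := by
    by_contra! hc
    have := hF.bounds (show s - 1 ≤ h - 2 * n by omega)
    have := H.zero_of_window hB (p := s) (by omega) (by omega)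
      (by rcases hs2 with h1 | h1 <;> omega)
    omega
  have hs6 : g - h ≤ h - s := by
    rcases H.min_le (by omega) le_rfl hs2 with h1 | h1 <;> omega
  have hr : g - 2 * n - t ≤ n := by
    by_contra! hc
    exact H.false_of_ones ha (u := t) (v := g - 2 * n) (by omega) (by omega) ht7 (by omega)
  obtain ⟨z, hz⟩ : ∃ z, z = h - F h - (t - F t) := ⟨_, rfl⟩
  have hz1 : z ≤ n - 1 - Q - (3 * n + 1 - h) := by omega
  have h00 := H.zeros_start hB (t := t) (by omega) (by omega)
  have hz2 : z + 1 ≤ 3 * n + 1 - h := by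
    have b1 := hF.bounds ht1
    have b2 := hF.bounds (show g - 2 * n ≤ h by omega)
    by_cases hc : h - F h - (0 - F 0) ≤ n
    · omega
    · obtain ⟨w, hw1, hw2, hw3, hw4⟩ := hF.exists_zero (a := g - 2 * n) (b := h) (k := h - F h)
        (by omega) (by omega)
      have e1 := hF.eq_of_le h00 (show 0 ≤ 1 by omega) (by omega)
      have hwh : w ≤ h - 1 := by
        by_contra! hc
        have : w = h := by omega
        subst this
        omega
      have := H.short (s := 1) (e := w) le_rfl hwh
        (good_zero (a' := 0) (b' := w - 1) e1 (by omega) (by omega) (by ring) rfl)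
      have b3 := hF.bounds hw1.le
      omega
  rcases le_or_gt (n + 2) (F L - F g) with hT | hT
  · obtain ⟨p, hp1, hp2, hp3, hp4⟩ := hF.exists_one (a := t) (b := h) (k := F h - n + 1)
      (by omega) (by omega)
    have b1 := hF.bounds hp1.le
    have b4 := hF.bounds hp2
    obtain ⟨y, hy1, hy2, hy3, hy4⟩ := hF.exists_one (a := g + 1) (b := L) (k := F g + 2) (by omega)
      (by omega)
    have good_y : Good n F y L := Or.inl ⟨by omega, one_L, by omega⟩
    have hy5 : L - y < g + 1 - p := by
      by_contra! hc
      exact avoid.pair (good_one (a := p) (b := g + 1) (a' := p - 1) (b' := g) (by omega) one_g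
        (by omega) rfl (by ring)) good_y (by omega) (by omega) le_rfl (by omega) hc
    obtain ⟨D, hD1, hD2, hD3⟩ : ∃ D, h - s ≤ D ∧ g - h + 1 ≤ D ∧ (D = h - s ∨ D = g - h + 1) := by
      rcases le_total (h - s) (g - h + 1) with h2 | h2
      · exact ⟨_, h2, le_rfl, Or.inr rfl⟩
      · exact ⟨_, le_rfl, h2, Or.inl rfl⟩
    have zeros₂ : ∀ v, g + 1 ≤ v → v ≤ y - 1 → F v = F h + 1 := fun v h1 h2 => by
      have := hF.eq_of_le (show F (y - 1) = F (g + 1) by omega) h1 h2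
      omega
    have good₁ : Good n F (h + 1) (h + 1 + D) := by
      have e1 := hF.eq_of_le run (show h ≤ h + 1 by omega) (by omega)
      have e2 := zeros₂ (h + 1 + D) (by omega) (by omega)
      have e3 := zeros₂ (h + D) (by omega) (by omega)
      exact good_zero (a' := h) (b' := h + D) e1 (by omega) (by omega) (by ring) (by ring)
    have hy6 : L - y < D := by
      by_contra! hc
      exact avoid.triple hs2 good₁ good_y (by omega) (by omega) (by omega) le_rfl (by omega)
        (by omega)
    exact avoid.triple hs2 good₁
      (hF.good_zeros (a := h + 2 + D) (b := y - 1) (u := g + 1) (v := y - 1) (by omega) (by omega)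
        (by omega) (by omega) (by omega))
      (by omega) (by omega) (by omega) (by omega) (by omega) (by omega)
  · obtain ⟨j, hj⟩ : ∃ j, j = h + (h - s) - F (h + (h - s)) - (h - F h) + 1 := ⟨_, rfl⟩
    have b0 := hF.bounds (show h ≤ h + (h - s) by omega)
    have b1 : n + 2 ≤ j := by
      have := hF.bounds (show g ≤ h + (h - s) by omega)
      omega
    obtain ⟨u, hu1, hu2, hu3, hu4⟩ := hF.exists_zero (a := h) (b := x) (k := h - F h + j)
      (by omega) (by omega)
    obtain ⟨w, hw1, hw2, hw3, hw4⟩ := hF.exists_zero (a := h) (b := x) (k := h - F h + j + 1)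
      (by omega) (by omega)
    have huw : u < w := by
      by_contra! hc
      have := hF.bounds hc
      omega
    have hu5 : h + 1 + (h - s) ≤ u := by
      by_contra! hc
      have := hF.bounds (show u ≤ h + (h - s) by omega)
      omega
    have b2 := hF.bounds huw.le
    have b3 := hF.bounds hw2
    have e1 := hF.eq_of_le run (show h ≤ h + 1 by omega) (by omega)
    exact H.avoids.triple hs2
      (good_zero (a := h + 1) (b := u) (a' := h) (b' := u - 1) (by omega) (by omega)
        (by omega) (by ring) rfl)
      (good_zero (a := w) (b := x) (a' := w - 1) (b' := x - 1) (by omega) (by omega) (by omega) rfl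
        rfl) (by omega) (by omega) (by omega) (by omega) (by omega) (by omega)

theorem false (H : ZeroRun n Q L h g x F) : False := by
  rcases le_or_gt (L - g) (2 * n) with hB | hB
  · exact H.false_of_short_end hB
  · rcases le_or_gt (g - h) n with ha | ha
    · rcases le_or_gt (F L - F g) (n + 1) with hT | hT
      · exact H.false_of_short_run_of_few_ones hB ha hT
      · exact H.false_of_short_run_of_many_ones hB ha (by omega)
    · exact H.false_of_long_run hB ha

end ZeroRun

/-! ### The first long pair and the color after it -/

section Tail

variable {n Q L s e W : ℤ} {F : ℤ → ℤ}

/-- Otherwise [1, 3n + 1] begins with n + 1 ones and ends with n + 1 zeros. These give two pairs of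
diameter n, and the remaining 2n + 1 or more integers contain a third good pair. -/
theorem Avoids.exists_long_of_one (H : Avoids n L F) (hn : 1 ≤ n) (hL : 5 * n + 2 ≤ L)
    (h1 : F 1 = F 0 + 1) :
    ∃ s e, 1 ≤ s ∧ e ≤ 3 * n + 1 ∧ Good n F s e ∧ 2 * n ≤ e - s := by
  by_contra! hc
  have hF := H.count
  have b0 := hF.bounds (show 1 ≤ 3 * n + 1 by omega)
  obtain ⟨p, hp1, hp2, hp3, hp4⟩ := hF.exists_one (a := 0) (b := 3 * n + 1) (k := F (3 * n + 1))
    (by omega) (by omega)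
  have b1 := hF.bounds hp2
  have b1' := hF.bounds (show 1 ≤ p by omega)
  rcases le_or_gt (3 * n + 1 - F (3 * n + 1) - (0 - F 0)) n with h0 | h0
  · have := hc 1 p le_rfl hp2 (good_one (a' := 0) (b' := p - 1) h1 (by omega) (by omega) (by ring)
      rfl)
    omega
  obtain ⟨q, hq1, hq2, hq3, hq4⟩ := hF.exists_zero (a := 0) (b := 3 * n + 1) (k := 0 - F 0 + 1)
    (by omega) (by omega)
  obtain ⟨w, hw1, hw2, hw3, hw4⟩ := hF.exists_zero (a := 0) (b := 3 * n + 1)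
    (k := 3 * n + 1 - F (3 * n + 1)) (by omega) (by omega)
  have b2 := hF.bounds hw2
  have hqw : q ≤ w := by
    by_contra! h2
    have := hF.bounds h2.le
    omega
  have b3 := hF.bounds hqw
  have d₀ := hc q w (by omega) hw2 (Or.inr ⟨by omega, by omega, by omega⟩)
  rcases le_or_gt (F (3 * n + 1) - F 0) n with h2 | h2
  · have := hF.bounds (show 0 ≤ q - 1 by omega)
    omega
  have d₁ := hc 1 p le_rfl hp2 (good_one (a' := 0) (b' := p - 1) h1 (by omega) (by omega) (by ring)
      rfl)
  have hw : w = 3 * n + 1 := by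
    rcases le_total p w with h3 | h3
    · have := hF.bounds h3
      omega
    · have := hF.bounds h3
      omega
  obtain ⟨a, b, ha, hb, hg⟩ := hF.exists_good (n := n) (by omega) (u := 3 * n + 1) (v := L)
    (by omega)
  have := hg.le_sub hF (by omega)
  exact H.triple
    (hF.good_ones (a := 1) (b := n + 1) (u := 0) (v := q - 1) (by omega) (by omega) (by omega)
      (by omega) (by omega))
    (hF.good_zeros (a := 2 * n + 1) (b := 3 * n + 1) (u := p) (v := 3 * n + 1) (by omega)
      (by omega) (by omega) (by omega) (by omega)) hg (by omega) (by omega) (by omega) hb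
      (by omega) (by omega)

theorem Avoids.exists_long (H : Avoids n L F) (hn : 1 ≤ n) (hL : 5 * n + 2 ≤ L) :
    ∃ s e, 1 ≤ s ∧ e ≤ 3 * n + 1 ∧ Good n F s e ∧ 2 * n ≤ e - s := by
  rcases H.count 1 with h1 | h1
  · obtain ⟨s, e, h2, h3, h4, h5⟩ := H.swap.exists_long_of_one hn hL (by
      have : F 1 = F 0 := h1
      omega)
    exact ⟨s, e, h2, h3, good_swap.1 h4, h5⟩
  · exact H.exists_long_of_one hn hL h1

/-- `(s, e)` is a good pair of diameter at least `2n` with `e` as small as possible. -/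
structure FirstLong (n Q L s e : ℤ) (F : ℤ → ℤ) : Prop where
  avoids : Avoids n L F
  n_pos : 1 ≤ n
  hQ : 2 * n ≤ 3 * Q + 2
  hQn : n + 1 ≤ 2 * Q
  hL : L = 6 * n + 2 + Q
  s_pos : 1 ≤ s
  e_le : e ≤ 3 * n + 1
  good : Good n F s e
  long : 2 * n ≤ e - s
  least : ∀ {a b : ℤ}, 1 ≤ a → Good n F a b → 2 * n ≤ b - a → e ≤ b

namespace FirstLong

theorem swap (H : FirstLong n Q L s e F) : FirstLong n Q L s e fun x => x - F x where
  avoids := H.avoids.swap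
  n_pos := H.n_pos
  hQ := H.hQ
  hQn := H.hQn
  hL := H.hL
  s_pos := H.s_pos
  e_le := H.e_le
  good := good_swap.2 H.good
  long := H.long
  least h1 h2 := H.least h1 (good_swap.1 h2)

theorem lt (H : FirstLong n Q L s e F) {a b : ℤ} (ha : e < a) (hb : b ≤ L) (hg : Good n F a b) :
    b - a < e - s := by
  by_contra! hc
  exact H.avoids.pair H.good hg H.s_pos ha hb H.long hc

/-- Here h is the last one up to e, g + 1 the first one after e, and x the last zero. A zero at L
would give a good pair from e + 1 to L that is too long; the same bound applied to x leaves Q + 1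
final ones. -/
theorem false_of_zero_first (H : FirstLong n Q L s e F) (h0 : F (e + 1) = F e)
    (c₁ : n + 1 ≤ F L - F e) (c₀ : n + 1 ≤ L - F L - (e - F e)) : False := by
  have hF := H.avoids.count
  have ⟨_, hn, hQ, hQn, hL, hs, he, _, hlong, _⟩ := H
  have b0 := hF.bounds (show 0 ≤ e by omega)
  have hone : F 0 < F e := by
    by_contra! hc
    obtain ⟨a, b, ha, hb, hg⟩ := hF.exists_good (n := n) (by omega) (u := e + 1) (v := L)
      (by omega)
    have := hg.le_sub hF (by omega)
    exact H.avoids.triple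
      (hF.good_zeros (a := 1) (b := n + 1) (u := 0) (v := e + 1) (by omega) (by omega) (by omega)
        (by omega) (by omega))
      (hF.good_zeros (a := n + 2) (b := 2 * n + 2) (u := 0) (v := e + 1) (by omega)
        (by omega) (by omega) (by omega) (by omega)) hg (by omega) (by omega) (by omega) hb
        (by omega) (by omega)
  obtain ⟨h, hh1, hh2, hh3, hh4⟩ := hF.exists_one (a := 0) (b := e) (k := F e) (by omega) le_rfl
  obtain ⟨p, hp1, hp2, hp3, hp4⟩ := hF.exists_one (a := e) (b := L) (k := F e + 1) (by omega)
    (by omega)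
  obtain ⟨g, rfl⟩ : ∃ g, p = g + 1 := ⟨p - 1, by ring⟩
  rw [add_sub_cancel_right] at hp4
  obtain ⟨x, hx1, hx2, hx3, hx4⟩ := hF.exists_zero (a := e) (b := L) (k := L - F L) (by omega)
    le_rfl
  have hge : e < g := by
    by_contra! hc
    have : g = e := by omega
    subst this
    omega
  have b1 := hF.bounds hx1.le
  have dx := H.lt (a := e + 1) (by omega) hx2 (good_zero (a' := e) (b' := x - 1) h0 (by omega)
    (by omega) (by ring) rfl)
  have one_L : F L = F (L - 1) + 1 := by
    rcases hF L with h1 | h1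
    · have := H.lt (a := e + 1) (by omega) le_rfl (good_zero (a' := e) (b' := L - 1) h0 (by omega)
        (by omega) (by ring) rfl)
      omega
    · exact h1
  have dg := H.lt (a := g + 1) (by omega) le_rfl (good_one (a' := g) (b' := L - 1) (by omega) one_L
    (by omega) (by ring) rfl)
  have hgx : g ≤ x := by
    by_contra! hc
    have := hF.bounds hc.le
    have := hF.bounds (show g ≤ L by omega)
    omega
  exact ZeroRun.false (h := h) (g := g) (x := x)
    { avoids := H.avoids, n_pos := hn, hQ := hQ, hQn := hQn, hL := hL, one_h := by omega,
      run := by omega, h_lt_g := by omega, one_g := by omega, one_L := one_L,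
      card_L := by omega, zero_x := hx4, ones_x := by omega, g_le_x := hgx, x_le := by omega,
      h_pos := by omega, h_le := by omega, L_sub_g := by omega,
      short := fun {a b} h1 h2 h3 => by
        by_contra! hc
        have := H.least h1 h3 hc
        omega }

theorem false_of_both (H : FirstLong n Q L s e F)
    (c₁ : n + 1 ≤ F L - F e) (c₀ : n + 1 ≤ L - F L - (e - F e)) : False := by
  rcases H.avoids.count (e + 1) with h | h <;> rw [add_sub_cancel_right] at h
  · exact H.false_of_zero_first h c₁ c₀
  · exact H.swap.false_of_zero_first (by omega) (by omega) (by omega)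

/-- If all good pairs of diameter at least `2n` that end at `e` have diameter at least `W`, then
there are many zeros before `e`, with few ones between them. -/
theorem exists_zeros (H : FirstLong n Q L s e F) (h1 : F e = F (e - 1) + 1)
    (hW : 2 * n + 1 + Q ≤ W)
    (hlong : ∀ a, 1 ≤ a → Good n F a e → 2 * n ≤ e - a → W ≤ e - a) :
    ∃ t f l, 1 ≤ t ∧ t < f ∧ f ≤ l ∧ l < e ∧ W ≤ e - t ∧ F t = F (t - 1) + 1 ∧ F e = F t + n ∧
      F f = F (f - 1) ∧ f - F f = t - F t + 1 ∧ F l = F (l - 1) ∧ l - F l = e - F e ∧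
      l - f < 2 * n := by
  have hF := H.avoids.count
  have ⟨_, hn, hQ, hQn, hL, hs, he, hgood, hse, _⟩ := H
  have hs' : F s = F (s - 1) + 1 ∧ n + 1 ≤ F e - F (s - 1) := by
    rcases hgood with h2 | h2 <;> omega
  -- With n + 1 ones this close to e, long pairs of ones force zeros both just before e - 2n and
  -- just before e; a long zero pair then ends at e - 1, against the choice of e.
  rcases le_or_gt (n + 1) (F e - F (e - 2 * n)) with hc | hc
  · exfalso
    have b0 := hF.bounds (show s ≤ e - 2 * n by omega)
    obtain ⟨a, ha1, ha2, ha3, ha4⟩ := hF.exists_one (a := s - 1) (b := e - 2 * n)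
      (k := F (e - 2 * n)) (by omega) le_rfl
    have d₁ := hlong a (by omega) (Or.inl ⟨by omega, h1, by omega⟩) (by omega)
    obtain ⟨r, hr1, hr2, hr3, hr4⟩ := hF.exists_one (a := e - 2 * n) (b := e - 1)
      (k := F (e - 1)) (by omega) le_rfl
    have d₂ : r - a < 2 * n := by
      by_contra! h2
      have := H.least (a := a) (b := r) (by omega) (Or.inl ⟨by omega, by omega, by omega⟩) h2
      omega
    have z₁ := hF.eq_of_le (u := a) (v := e - 2 * n) (x := a + 1) (by omega) (by omega) (by omega)
    have z₂ := hF.eq_of_le (u := r) (v := e - 1) (x := e - 2) (by omega) (by omega) (by omega)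
    have b1 := hF.bounds hr1.le
    have : n + 1 ≤ e - 1 - F (e - 1) - (a - F a) := by omega
    have := H.least (a := a + 1) (b := e - 1) (by omega)
      (good_zero (a' := a) (b' := e - 2) z₁ (by omega) (by omega) (by ring) (by ring)) (by omega)
    omega
  · obtain ⟨t, ht1, ht2, ht3, ht4⟩ := hF.exists_one (a := s - 1) (b := e) (k := F e - n)
      (by omega) (by omega)
    have ht : t ≤ e - 2 * n := by
      by_contra! h2
      have := hF.bounds (show e - 2 * n ≤ t - 1 by omega)
      omega
    have d₁ := hlong t (by omega) (Or.inl ⟨by omega, h1, by omega⟩) (by omega)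
    obtain ⟨f, hf1, hf2, hf3, hf4⟩ := hF.exists_zero (a := t) (b := e) (k := t - F t + 1)
      (by omega) (by omega)
    obtain ⟨l, hl1, hl2, hl3, hl4⟩ := hF.exists_zero (a := t) (b := e) (k := e - F e)
      (by omega) (by omega)
    have hle : l < e := by
      by_contra! h2
      have : l = e := by omega
      subst this
      omega
    have hfl : f ≤ l := by
      by_contra! h2
      have := hF.bounds h2.le
      omega
    refine ⟨t, f, l, by omega, hf1, hfl, hle, d₁, by omega, by omega, hf4, hf3, hl4, hl3, ?_⟩
    by_contra! h2
    have := H.least (a := f) (b := l) (by omega) (Or.inr ⟨by omega, by omega, by omega⟩) h2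
    omega

end FirstLong

end Tail

/-! ### Tails poor in one color -/

section Tail

variable {n Q L s e W : ℤ} {F : ℤ → ℤ}

/-- Two consecutive good pairs in an interval `[u, v]` with few zeros that starts and ends with a
one. -/
theorem IsCount.exists_two_ones (hF : IsCount F) {u v j k : ℤ} (hn : 0 ≤ n) (hk : 0 ≤ k)
    (huv : u ≤ v) (hu : F u = F (u - 1) + 1) (hv : F v = F (v - 1) + 1)
    (hj : v - u + 1 - (F v - F (u - 1)) ≤ j) (hW : 2 * n + 2 + 2 * k + 2 * j ≤ v - u + 1) :
    ∃ b a, b < a ∧ Good n F u b ∧ Good n F a v ∧ n + k ≤ b - u ∧ b - u ≤ v - a := by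
  have huv := hF.bounds (show u - 1 ≤ v by omega)
  obtain ⟨b, hb1, hb2, hb3, hb4⟩ := hF.exists_one (a := u - 1) (b := v)
    (k := F (u - 1) + n + 1 + k) (by omega) (by omega)
  obtain ⟨a, ha1, ha2, ha3, ha4⟩ := hF.exists_one (a := u - 1) (b := v)
    (k := F (u - 1) + n + 2 + k) (by omega) (by omega)
  have hba : b < a := by
    by_contra! hc
    have := hF.bounds hc
    omega
  have b1 := hF.bounds hb1.le
  have b2 := hF.bounds hb2
  have b3 := hF.bounds (show a - 1 ≤ v by omega)
  have b4 := hF.bounds (show u - 1 ≤ a - 1 by omega)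
  exact ⟨b, a, hba, Or.inl ⟨hu, by omega, by omega⟩, Or.inl ⟨by omega, hv, by omega⟩, by omega,
    by omega⟩

theorem IsCount.exists_two_zeros (hF : IsCount F) {u v j k : ℤ} (hn : 0 ≤ n) (hk : 0 ≤ k)
    (huv : u ≤ v) (hu : F u = F (u - 1)) (hv : F v = F (v - 1))
    (hj : F v - F (u - 1) ≤ j) (hW : 2 * n + 2 + 2 * k + 2 * j ≤ v - u + 1) :
    ∃ b a, b < a ∧ Good n F u b ∧ Good n F a v ∧ n + k ≤ b - u ∧ b - u ≤ v - a := by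
  obtain ⟨b, a, h1, h2, h3, h4⟩ := hF.swap.exists_two_ones (n := n) (u := u) (v := v) (j := j) hn hk
    huv (by omega) (by omega) (by omega) hW
  exact ⟨b, a, h1, good_swap.1 h2, good_swap.1 h3, h4⟩

namespace FirstLong

/-- The first good pair of zeros before `e`. The last part describes the extremal case. -/
theorem exists_first_zeros (H : FirstLong n Q L s e F) (h1 : F e = F (e - 1) + 1)
    (hW : 2 * n + 1 + Q ≤ W)
    (hlong : ∀ a, 1 ≤ a → Good n F a e → 2 * n ≤ e - a → W ≤ e - a) :
    ∃ f z y, Good n F f z ∧ 1 ≤ f ∧ z < e ∧ z - f ≤ n + y ∧ 0 ≤ y ∧ y ≤ 3 * n - W ∧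
      ∀ r, n = 3 * r + 1 → e = 9 * r + 4 → W = 8 * r + 3 → y = r → z - f = n + y →
        F z = F (z - 1) ∧ F (e - 1) = F z ∧ z = e - 1 - 2 * r := by
  have hF := H.avoids.count
  obtain ⟨t, f, l, ht, htf, hfl, hle, hWt, ht1, het, hf0, hf, hl0, hl, hlf⟩ :=
    H.exists_zeros h1 hW hlong
  have ⟨_, hn, hQ, hQn, hL, hs, he, hgood, hse, _⟩ := H
  obtain ⟨z, hz1, hz2, hz3, hz4⟩ := hF.exists_zero (a := f - 1) (b := l) (k := f - F f + n)
    (by omega) (by omega)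
  have b1 := hF.bounds hz2
  have b2 := hF.bounds (show f - 1 ≤ z by omega)
  have b3 := hF.bounds hfl
  refine ⟨f, z, F l - F f, Or.inr ⟨hf0, hz4, by omega⟩, by omega, by omega, by omega, by omega,
    by omega, fun r hr her hWr hy hzf => ?_⟩
  -- Here `hW` gives Q ≤ 2r, and then n + 1 ≤ 2Q excludes r ≤ 1.
  have hr2 : 2 ≤ r := by omega
  have hstart : F (t - 1) - F 0 = t - 1 - 0 := by
    have b4 := hF.bounds (show 0 ≤ t - 1 by omega)
    by_contra hc
    obtain ⟨p, hp1, hp2, hp3, hp4⟩ := hF.exists_zero (a := 0) (b := t - 1) (k := 0 - F 0 + 1)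
      (by omega) (by omega)
    have b5 := hF.bounds (show p - 1 ≤ f - 1 by omega)
    have := H.least (a := p) (b := l) (by omega) (Or.inr ⟨by omega, hl0, by omega⟩) (by omega)
    omega
  have hl1 : l = e - 1 := by
    by_contra hc
    have b4 := hF.bounds (show l ≤ e - 2 by omega)
    have b5 := hF.bounds (show e - 2 ≤ e - 1 by omega)
    have e1 := hF.eq_add_of_le hstart (show 0 ≤ 1 by omega) (by omega)
    have := H.least (a := 1) (b := e - 1) le_rfl
      (good_one (a' := 0) (b' := e - 2) (by omega) (by omega) (by omega) (by ring) (by ring))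
      (by omega)
    omega
  subst hl1
  omega

/-- The tail after `e` contains few zeros. -/
theorem false_of_few_zeros (H : FirstLong n Q L s e F) (h1 : F e = F (e - 1) + 1)
    (hc : L - F L - (e - F e) ≤ n) : False := by
  have hF := H.avoids.count
  have ⟨_, hn, hQ, hQn, hL, hs, he, _, hse, _⟩ := H
  obtain ⟨u, hu1, hu2, hu3, hu4⟩ := hF.exists_one (a := e) (b := L) (k := F e + 1) (by omega)
    (by omega)
  obtain ⟨v, hv1, hv2, hv3, hv4⟩ := hF.exists_one (a := e) (b := L) (k := F L) (by omega)
    (by omega)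
  have b1 := hF.bounds (show e ≤ u - 1 by omega)
  have b2 := hF.bounds hv2
  have b3 := hF.bounds (show e ≤ v by omega)
  have huv : u ≤ v := by
    by_contra! h
    have := hF.bounds h.le
    omega
  have b4 := hF.bounds (show u - 1 ≤ v by omega)
  have good_uv : Good n F u v := Or.inl ⟨by omega, by omega, by omega⟩
  have key : ∀ {a b : ℤ}, 1 ≤ a → b < u → Good n F a b → 2 * n ≤ b - a → v - u + 1 ≤ b - a := by
    intro a b ha hb hg hd
    by_contra! h
    exact H.avoids.pair hg good_uv ha hb hv2 hd (by omega)
  obtain ⟨f, z, y, hfz, hf, hz, hy, hy0, hyW, hex⟩ := H.exists_first_zeros (W := v - u + 1) h1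
    (by omega) (fun a ha hg hd => key ha hu1 hg hd)
  have two : ∀ k, 0 ≤ k → z - f ≤ n + k →
      2 * n + 2 + 2 * k + 2 * (v - u + 1 - (F v - F (u - 1))) ≤ v - u + 1 → False := by
    intro k hk hzk hW
    obtain ⟨b, a, hba, g₂, g₃, d₁, d₂⟩ := hF.exists_two_ones (n := n) (u := u) (v := v) (k := k)
      (by omega) hk huv (by omega) (by omega) le_rfl hW
    exact H.avoids.triple hfz g₂ g₃ hf (by omega) hba hv2 (by omega) (by omega)
  -- With W = v - u + 1 and j zeros in [u, v], failure of this inequality and y ≤ 3n - W give 3W ≤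
  -- 8n + 1 + 2j, whereas the length of the tail gives 3W ≥ 8n + 1 + 3j. So j = 0 and every estimate
  -- is sharp.
  by_cases h2 : 2 * n + 2 + 2 * y + 2 * (v - u + 1 - (F v - F (u - 1))) ≤ v - u + 1
  · exact two y hy0 hy h2
  have hj : 2 * n + 1 + Q + (v - u + 1 - (F v - F (u - 1))) ≤ v - u + 1 := by omega
  have hj0 : 0 ≤ v - u + 1 - (F v - F (u - 1)) := by omega
  have hnW : 3 * (v - u + 1) = 8 * n + 1 := by omega
  obtain ⟨r, hr⟩ : ∃ r, n = 3 * r + 1 := ⟨(n - 1) / 3, by omega⟩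
  have hW : v - u + 1 = 8 * r + 3 := by omega
  have hQr : Q = 2 * r := by omega
  have her : e = 9 * r + 4 := by omega
  have hyr : y = r := by omega
  have hzf : z - f = n + y := by
    by_contra h3
    exact two (y - 1) (by omega) (by omega) (by omega)
  obtain ⟨z0, ze, hz2⟩ := hex r hr her hW hyr hzf
  have hsolid : F v - F (u - 1) = v - (u - 1) := by omega
  have ones : ∀ w, u - 1 ≤ w → w ≤ v → F w = F e + (w - (u - 1)) := fun w h3 h4 => by
    have := hF.eq_add_of_le hsolid h3 h4
    omega
  have zeros : ∀ w, e ≤ w → w ≤ u - 1 → F w = F e := fun w h3 h4 =>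
    hF.eq_of_le (show F (u - 1) = F e by omega) h3 h4
  have good₂ : ∀ b, u ≤ b → b ≤ v → n + 1 ≤ F e + (b - (u - 1)) - F (e - 1) → Good n F e b := by
    intro b h3 h4 h5
    have e1 := ones b (by omega) h4
    have e2 := ones (b - 1) (by omega) (by omega)
    exact Or.inl ⟨h1, by omega, by omega⟩
  have good₃ : ∀ a, u ≤ a → n ≤ v - a → Good n F a v := fun a h3 h4 =>
    hF.good_ones hsolid (by omega) (by omega) le_rfl h4
  -- In the extremal case only the gap between e and the solid block [u, v] is free. A small gap
  -- lets a pair of ones start at e; a large one completes a zero pair from z + 1 to u - 1.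
  rcases le_or_gt (u - 1 - e) r with h3 | h3
  · exact H.avoids.triple hfz (good₂ (e + 4 * r + 1) (by omega) (by omega) (by omega))
      (good₃ (e + 4 * r + 2) (by omega) (by omega)) hf hz (by omega) hv2 (by omega) (by omega)
  · rcases le_or_gt (u - 1 - e) (2 * r) with h4 | h4
    · exact H.avoids.triple hfz (good₂ (u - 1 + n) (by omega) (by omega) (by omega))
        (good₃ (u + n) (by omega) (by omega)) hf hz (by omega) hv2 (by omega) (by omega)
    · have e1 := zeros (u - 1) (by omega) le_rfl
      have e2 := zeros (u - 2) (by omega) (by omega)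
      have e3 := hF.eq_of_le ze (show z ≤ z + 1 by omega) (by omega)
      exact H.avoids.triple hfz
        (good_zero (a := z + 1) (b := u - 1) (a' := z) (b' := u - 2) e3 (by omega) (by omega)
          (by ring) (by ring)) (good₃ u le_rfl (by omega)) hf (by omega) (by omega) hv2 (by omega)
        (by omega)

/-- The tail after `e` contains few ones. -/
theorem false_of_few_ones (H : FirstLong n Q L s e F) (h1 : F e = F (e - 1) + 1)
    (hc : F L - F e ≤ n) : False := by
  have hF := H.avoids.count
  have ⟨_, hn, hQ, hQn, hL, hs, he, _, hse, _⟩ := H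
  obtain ⟨u, hu1, hu2, hu3, hu4⟩ := hF.exists_zero (a := e) (b := L) (k := e - F e + 1) (by omega)
    (by omega)
  obtain ⟨v, hv1, hv2, hv3, hv4⟩ := hF.exists_zero (a := e) (b := L) (k := L - F L) (by omega)
    (by omega)
  have b1 := hF.bounds (show e ≤ u - 1 by omega)
  have b2 := hF.bounds hv2
  have b3 := hF.bounds (show e ≤ v by omega)
  have huv : u ≤ v := by
    by_contra! h
    have := hF.bounds h.le
    omega
  have b4 := hF.bounds (show u - 1 ≤ v by omega)
  have good_uv : Good n F u v := Or.inr ⟨by omega, by omega, by omega⟩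
  have key : ∀ {a b : ℤ}, 1 ≤ a → b < u → Good n F a b → 2 * n ≤ b - a → v - u + 1 ≤ b - a := by
    intro a b ha hb hg hd
    by_contra! h
    exact H.avoids.pair hg good_uv ha hb hv2 hd (by omega)
  obtain ⟨f, z, y, hfz, hf, hz, hy, hy0, hyW, hex⟩ := H.exists_first_zeros (W := v - u + 1) h1
    (by omega) (fun a ha hg hd => key ha hu1 hg hd)
  have two : ∀ k, 0 ≤ k → z - f ≤ n + k →
      2 * n + 2 + 2 * k + 2 * (F v - F (u - 1)) ≤ v - u + 1 → False := by
    intro k hk hzk hW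
    obtain ⟨b, a, hba, g₂, g₃, d₁, d₂⟩ := hF.exists_two_zeros (n := n) (u := u) (v := v) (k := k)
      (by omega) hk huv hu4 hv4 le_rfl hW
    exact H.avoids.triple hfz g₂ g₃ hf (by omega) hba hv2 (by omega) (by omega)
  by_cases h2 : 2 * n + 2 + 2 * y + 2 * (F v - F (u - 1)) ≤ v - u + 1
  · exact two y hy0 hy h2
  have hj : 2 * n + 1 + Q + (F v - F (u - 1)) ≤ v - u + 1 := by omega
  have hj0 : 0 ≤ F v - F (u - 1) := by omega
  have hnW : 3 * (v - u + 1) = 8 * n + 1 := by omega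
  obtain ⟨r, hr⟩ : ∃ r, n = 3 * r + 1 := ⟨(n - 1) / 3, by omega⟩
  have hW : v - u + 1 = 8 * r + 3 := by omega
  have hQr : Q = 2 * r := by omega
  have her : e = 9 * r + 4 := by omega
  have hyr : y = r := by omega
  have hzf : z - f = n + y := by
    by_contra h3
    exact two (y - 1) (by omega) (by omega) (by omega)
  obtain ⟨z0, ze, hz2⟩ := hex r hr her hW hyr hzf
  have hsolid : F v = F (u - 1) := by omega
  have zeros : ∀ w, u - 1 ≤ w → w ≤ v → F w = F (u - 1) := fun w h3 h4 => hF.eq_of_le hsolid h3 h4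
  have good₂ : ∀ a b, z ≤ a → a < e → u ≤ b → b ≤ v →
      n + 1 ≤ b - F (u - 1) - (a - 1 - F z) → Good n F a b := by
    intro a b h3 h3' h4 h5 h6
    have e1 := zeros b (by omega) h5
    have e2 := zeros (b - 1) (by omega) (by omega)
    rcases h3.eq_or_lt with rfl | h3
    · exact Or.inr ⟨z0, by omega, by omega⟩
    · have e3 := hF.eq_of_le ze (show z ≤ a by omega) (by omega)
      have e4 := hF.eq_of_le ze (show z ≤ a - 1 by omega) (by omega)
      exact Or.inr ⟨by omega, by omega, by omega⟩
  have good₃ : ∀ a, u ≤ a → n ≤ v - a → Good n F a v := fun a h3 h4 =>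
    hF.good_zeros hsolid (by omega) (by omega) le_rfl h4
  -- The zeros just before e now join the solid block of zeros across the gap; for a wide gap the
  -- joined pair reaches diameter 2n and `pair` applies.
  rcases le_or_gt (u - 1 - e) (r - 2) with h3 | h3
  · exact H.avoids.triple hfz
      (good₂ (z + 1) (e + 2 * r + 1) (by omega) (by omega) (by omega) (by omega) (by omega))
      (good₃ (e + 2 * r + 2) (by omega) (by omega)) hf (by omega) (by omega) hv2 (by omega)
      (by omega)
  · rcases le_or_gt (u - 1 - e) (3 * r) with h4 | h4
    · exact H.avoids.triple hfz
        (good₂ (z + 1) (u + r + 1) (by omega) (by omega) (by omega) (by omega) (by omega))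
        (good₃ (u + r + 2) (by omega) (by omega)) hf (by omega) (by omega) hv2 (by omega)
        (by omega)
    · exact H.avoids.pair
        (good₂ z (u + r) (by omega) (by omega) (by omega) (by omega) (by omega))
        (good₃ (u + r + 1) (by omega) (by omega)) (by omega) (by omega) hv2 (by omega) (by omega)

theorem false_of_one (H : FirstLong n Q L s e F) (h1 : F e = F (e - 1) + 1) : False := by
  rcases le_or_gt (F L - F e) n with h2 | h2
  · exact H.false_of_few_ones h1 h2
  · rcases le_or_gt (L - F L - (e - F e)) n with h3 | h3
    · exact H.false_of_few_zeros h1 h3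
    · exact H.false_of_both h2 h3

end FirstLong

theorem Avoids.false (H : Avoids n L F) (hn : 1 ≤ n) (hQ : 2 * n ≤ 3 * Q + 2)
    (hQn : n + 1 ≤ 2 * Q) (hL : L = 6 * n + 2 + Q) : False := by
  obtain ⟨e, ⟨s, hs, he, hg, hd⟩, hmin⟩ := Int.exists_least_of_bdd
    (P := fun e => ∃ s, 1 ≤ s ∧ e ≤ 3 * n + 1 ∧ Good n F s e ∧ 2 * n ≤ e - s)
    ⟨0, fun z ⟨s, h1, h2, h3, h4⟩ => by omega⟩ (by
      obtain ⟨s, e, h⟩ := H.exists_long hn (by omega)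
      exact ⟨e, s, h⟩)
  have F₀ : FirstLong n Q L s e F :=
    { avoids := H, n_pos := hn, hQ := hQ, hQn := hQn, hL := hL, s_pos := hs, e_le := he, good := hg,
      long := hd
      least := fun {a b} h1 h2 h3 => by
        rcases le_or_gt b (3 * n + 1) with h4 | h4
        · exact hmin b ⟨a, h1, h4, h2, h3⟩
        · omega }
  rcases H.count e with h1 | h1
  · exact F₀.swap.false_of_one (by omega)
  · exact F₀.false_of_one h1

end Tail

/-! ### Exhaustive search for n = 2 -/

section Search

/-- The entry at index `d` of `hist` belongs to the prefix that ends `d` steps before the last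
treated position. It bounds the least diameter of a good pair in this prefix, and the least
diameter of a second good pair. The function treats the good pairs `(s, e)` with `s` in a list. -/
def scan (n e : ℕ) (hist : List (ℕ × ℕ)) : List ℕ → ℕ × ℕ → Option (ℕ × ℕ)
  | [], c => some c
  | s :: l, c =>
    -- The last treated position is e - 1, so index e - s is the prefix ending at s - 1; 100 plays
    -- the role of infinity.
    let p := hist.getD (e - s) (100, 100)
    if p.2 ≤ e - s then none
    else scan n e hist l
      (min c.1 (e - s), if 2 * n ≤ e - s ∨ p.1 ≤ e - s then min c.2 (e - s) else c.2)

/-- A search for colorings that avoid solutions: `p₀` and `p₁` are the positions of the zeros and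
ones among the first `i` positions. -/
def search (n : ℕ) : ℕ → ℕ → List ℕ → List ℕ → List (ℕ × ℕ) → Bool
  | 0, _, _, _, _ => false
  | k + 1, i, p₀, p₁, hist =>
    (match scan n (i + 1) hist (p₀.drop (n - 1)) (hist.getD 0 (100, 100)) with
      | none => true
      | some c => search n k (i + 1) ((i + 1) :: p₀) p₁ (c :: hist)) &&
    (match scan n (i + 1) hist (p₁.drop (n - 1)) (hist.getD 0 (100, 100)) with
      | none => true
      | some c => search n k (i + 1) p₀ ((i + 1) :: p₁) (c :: hist))

theorem search_two : search 2 15 0 [] [] [(100, 100)] = true := by decide +kernel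

/-- The entries of `p` are positions of ones in `[1, i]`, listed from the right. -/
def OnesBefore (F : ℤ → ℤ) (i : ℕ) (p : List ℕ) : Prop :=
  ∀ k s : ℕ, p[k]? = some s →
    1 ≤ s ∧ s ≤ i ∧ F s = F (s - 1) + 1 ∧ (k : ℤ) + 1 ≤ F i - F (s - 1)

/-- The good pairs to the right of `i` have diameter less than `c.2`, and two consecutive ones with
nondecreasing diameters start with a diameter less than `c.1`. -/
def Bounded (n L : ℤ) (F : ℤ → ℤ) (i : ℤ) (c : ℕ × ℕ) : Prop :=
  (∀ {a b a' b' : ℤ}, Good n F a b → Good n F a' b' → i < a → b < a' → b' ≤ L → c.1 ≤ b - a →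
    b - a ≤ b' - a' → False) ∧
  ∀ {a b : ℤ}, Good n F a b → i < a → b ≤ L → c.2 ≤ b - a → False

variable {n L i : ℕ} {F : ℤ → ℤ} {p : List ℕ} {hist : List (ℕ × ℕ)} {c : ℕ × ℕ}

theorem OnesBefore.cons (h : OnesBefore F i p) (hF : F (i + 1) = F i + 1) :
    OnesBefore F (i + 1) ((i + 1) :: p) := by
  intro k s hs
  rcases k with - | k
  · simp only [List.getElem?_cons_zero, Option.some.injEq] at hs
    subst hs
    refine ⟨by omega, le_rfl, ?_, ?_⟩ <;> push_cast <;> rw [add_sub_cancel_right] <;> omega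
  · obtain ⟨h1, h2, h3, h4⟩ := h k s (by simpa using hs)
    push_cast
    omega

theorem OnesBefore.succ (h : OnesBefore F i p) (hF : F i ≤ F (i + 1)) :
    OnesBefore F (i + 1) p := by
  intro k s hs
  obtain ⟨h1, h2, h3, h4⟩ := h k s hs
  push_cast
  omega

theorem OnesBefore.good (h : OnesBefore F i p) (hF : F (i + 1) = F i + 1) {s : ℕ}
    (hs : s ∈ p.drop (n - 1)) : 1 ≤ s ∧ s ≤ i ∧ Good n F s (i + 1 : ℕ) := by
  obtain ⟨k, hk⟩ := List.mem_iff_getElem?.1 hs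
  -- Dropping n - 1 entries leaves starts with at least n ones up to i; the new one at i + 1
  -- completes n + 1.
  rw [List.getElem?_drop] at hk
  obtain ⟨h1, h2, h3, h4⟩ := h _ s hk
  refine ⟨h1, h2, Or.inl ⟨h3, ?_, ?_⟩⟩
  · push_cast
    rwa [add_sub_cancel_right]
  · push_cast at h4 ⊢
    omega

theorem scan_sound (hA : Avoids n L F) (hi : i + 1 ≤ L)
    (hh : ∀ d ≤ i, Bounded n L F (i - d : ℕ) (hist.getD d (100, 100))) (l : List ℕ)
    (hl : ∀ s ∈ l, 1 ≤ s ∧ s ≤ i ∧ Good n F s (i + 1 : ℕ)) (hc : Bounded n L F (i + 1 : ℕ) c) :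
    ∃ c', scan n (i + 1) hist l c = some c' ∧ Bounded n L F (i + 1 : ℕ) c' := by
  induction l generalizing c with
  | nil => exact ⟨c, rfl, hc⟩
  | cons s l ih =>
    obtain ⟨h1, h2, hg⟩ := hl s List.mem_cons_self
    have hp := hh (i + 1 - s) (by omega)
    rw [show i - (i + 1 - s) = s - 1 by omega] at hp
    simp only [scan]
    set p := hist.getD (i + 1 - s) (100, 100)
    rw [if_neg fun hcon => hp.2 hg (by omega) (by omega) (by omega)]
    refine ih (fun t ht => hl t (List.mem_cons_of_mem _ ht)) ⟨?_, ?_⟩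
    · intro a b a' b' g g' k1 k2 k3 k4 k5
      rcases le_or_gt (c.1 : ℤ) (b - a) with h | h
      · exact hc.1 g g' k1 k2 k3 h k5
      · exact hA.triple hg g g' (by omega) k1 k2 k3 (by dsimp only at k4; omega) k5
    · intro a b g k1 k2 k3
      rcases le_or_gt (c.2 : ℤ) (b - a) with h | h
      · exact hc.2 g k1 k2 h
      · dsimp only at k3
        split_ifs at k3 with h'
        · rcases h' with h' | h'
          · exact hA.pair hg g (by omega) k1 k2 (by omega) (by omega)
          · exact hp.1 hg g (by omega) k1 k2 (by omega) (by omega)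
        · omega

theorem search_sound (hA : Avoids n L F) (k : ℕ) {p₀ p₁ : List ℕ} (hi : i + k = L)
    (h₀ : OnesBefore (fun x => x - F x) i p₀) (h₁ : OnesBefore F i p₁)
    (hh : ∀ d ≤ i, Bounded n L F (i - d : ℕ) (hist.getD d (100, 100))) :
    search n k i p₀ p₁ hist = false := by
  induction k generalizing i p₀ p₁ hist with
  | zero => rfl
  | succ k ih =>
    have hc : Bounded n L F (i + 1 : ℕ) (hist.getD 0 (100, 100)) := by
      have := hh 0 (by omega)
      exact ⟨fun g g' h => this.1 g g' (by omega), fun g h => this.2 g (by omega)⟩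
    have hstep : ∀ c', Bounded n L F (i + 1 : ℕ) c' → ∀ d ≤ i + 1,
        Bounded n L F (i + 1 - d : ℕ) ((c' :: hist).getD d (100, 100)) := by
      rintro c' hc' (- | d) hd
      · exact hc'
      · rw [show i + 1 - (d + 1) = i - d by omega]
        exact hh d (by omega)
    have hF := hA.count (i + 1)
    rw [add_sub_cancel_right] at hF
    simp only [search, Bool.and_eq_false_iff]
    rcases hF with hF | hF
    · left
      have hF' : (fun x => x - F x) ((i : ℤ) + 1) = (fun x => x - F x) (i : ℤ) + 1 := by
        dsimp only
        omega
      obtain ⟨c', e, hc'⟩ := scan_sound hA (by omega) hh _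
        (fun s hs => by
          obtain ⟨h1, h2, h3⟩ := h₀.good (n := n) hF' hs
          exact ⟨h1, h2, good_swap.1 h3⟩) hc
      rw [e]
      exact ih (by omega) (h₀.cons hF') (h₁.succ (by omega)) (hstep c' hc')
    · right
      obtain ⟨c', e, hc'⟩ := scan_sound hA (by omega) hh _
        (fun s hs => h₁.good (n := n) hF hs) hc
      rw [e]
      exact ih (by omega) (h₀.succ (by omega)) (h₁.cons hF) (hstep c' hc')

theorem Avoids.false_of_two (hA : Avoids 2 15 F) : False := by
  have h := search_sound (n := 2) (L := 15) (i := 0) (hist := [(100, 100)]) hA 15 rfl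
    (p₀ := []) (p₁ := []) (fun k s hs => by simp at hs) (fun k s hs => by simp at hs) ?_
  · rw [search_two] at h
    exact absurd h (by decide)
  · intro d hd
    obtain rfl : d = 0 := by omega
    refine ⟨?_, ?_⟩
    · intro a b a' b' g g' h1 h2 h3 h4 h5
      have := g'.le_sub hA.count (by norm_num)
      simp at h4 h1
      omega
    · intro a b g h1 h2 h3
      simp at h3 h1
      omega

end Search

/-! ### From colorings and sets to counting functions and good pairs -/

section Colorings

open Finset

/-- `F` counts, up to an additive constant, the elements of color `1` in initial segments. -/
def Encodes (Δ : ℤ → Fin 2) (F : ℤ → ℤ) : Prop :=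
  ∀ x, 1 ≤ x → F x = F (x - 1) + ((Δ x : ℕ) : ℤ)

variable {n : ℕ} {Δ : ℤ → Fin 2} {F : ℤ → ℤ} {a b N : ℤ}

theorem exists_encodes (Δ : ℤ → Fin 2) : ∃ F, IsCount F ∧ Encodes Δ F := by
  have key : ∀ x : ℤ, 1 ≤ x → ∑ y ∈ Icc 1 x, ((Δ y : ℕ) : ℤ) =
      ∑ y ∈ Icc 1 (x - 1), ((Δ y : ℕ) : ℤ) + ((Δ x : ℕ) : ℤ) := fun x hx => by
    rw [show Icc 1 x = insert x (Icc 1 (x - 1)) by ext; simp only [mem_Icc, mem_insert]; omega,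
      sum_insert (by simp), add_comm]
  refine ⟨fun x => ∑ y ∈ Icc 1 x, ((Δ y : ℕ) : ℤ), fun x => ?_, key⟩
  rcases le_or_gt 1 x with hx | hx
  · have := key x hx
    dsimp only
    have := (Δ x).isLt
    omega
  · left
    dsimp only
    rw [Icc_eq_empty (by omega), Icc_eq_empty (by omega)]

theorem Encodes.card_filter (h : Encodes Δ F) (ha : 1 ≤ a) (hab : a - 1 ≤ b) :
    (#{x ∈ Icc a b | Δ x = 1} : ℤ) = F b - F (a - 1) ∧
      (#{x ∈ Icc a b | Δ x = 0} : ℤ) = b - F b - (a - 1 - F (a - 1)) := by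
  induction b, hab using Int.leInduction with
  | base => simp
  | succ k hk ih =>
    have hI : Icc a (k + 1) = insert (k + 1) (Icc a k) := by
      ext
      simp only [mem_Icc, mem_insert]
      omega
    have hk' := h (k + 1) (by omega)
    rw [add_sub_cancel_right] at hk'
    rw [hI, filter_insert, filter_insert]
    have hd : Δ (k + 1) = 0 ∨ Δ (k + 1) = 1 := by
      generalize Δ (k + 1) = c
      revert c
      decide
    rcases hd with hd | hd
    · rw [hd] at hk'
      rw [if_neg (by rw [hd]; decide), if_pos hd, card_insert_of_notMem (by simp)]
      push_cast at hk' ⊢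
      simp only [Fin.val_zero, Nat.cast_zero] at hk'
      omega
    · rw [hd] at hk'
      rw [if_pos hd, if_neg (by rw [hd]; decide), card_insert_of_notMem (by simp)]
      push_cast at hk' ⊢
      simp only [Fin.val_one, Nat.cast_one] at hk'
      omega

theorem Encodes.good_iff (h : Encodes Δ F) (ha : 1 ≤ a) (hab : a ≤ b) :
    Good n F a b ↔ ∃ c, Δ a = c ∧ Δ b = c ∧ n + 1 ≤ #{x ∈ Icc a b | Δ x = c} := by
  obtain ⟨h1, h0⟩ := h.card_filter ha (b := b) (by omega)
  have ea := h a ha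
  have eb := h b (by omega)
  have hc : ∀ c : Fin 2, ((c : ℕ) : ℤ) = 0 ∧ c = 0 ∨ ((c : ℕ) : ℤ) = 1 ∧ c = 1 := by decide
  constructor
  · rintro (⟨k1, k2, k3⟩ | ⟨k1, k2, k3⟩)
    · refine ⟨1, ?_, ?_, by omega⟩
      · have := hc (Δ a)
        omega
      · have := hc (Δ b)
        omega
    · refine ⟨0, ?_, ?_, by omega⟩
      · have := hc (Δ a)
        omega
      · have := hc (Δ b)
        omega
  · rintro ⟨c, rfl, k2, k3⟩
    rw [k2] at eb
    rcases hc (Δ a) with ⟨k, k'⟩ | ⟨k, k'⟩ <;> rw [k'] at k3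
    · exact Or.inr ⟨by omega, by omega, by omega⟩
    · exact Or.inl ⟨by omega, by omega, by omega⟩

/-- The set `B` has the extremal elements `a` and `b`. -/
def Spans (B : Finset ℤ) (a b : ℤ) : Prop := a ∈ B ∧ b ∈ B ∧ B ⊆ Icc a b

theorem Spans.max'_eq {B : Finset ℤ} (h : Spans B a b) (hB : B.Nonempty) : B.max' hB = b :=
  (B.max'_eq_iff hB b).2 ⟨h.2.1, fun _ hx => (mem_Icc.1 (h.2.2 hx)).2⟩

theorem Spans.min'_eq {B : Finset ℤ} (h : Spans B a b) (hB : B.Nonempty) : B.min' hB = a :=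
  (B.min'_eq_iff hB a).2 ⟨h.1, fun _ hx => (mem_Icc.1 (h.2.2 hx)).1⟩

theorem Spans.diam_eq {B : Finset ℤ} (h : Spans B a b) : diam B = b - a := by
  have hB : B.Nonempty := ⟨a, h.1⟩
  rw [diam, dif_pos hB, h.max'_eq, h.min'_eq]

theorem Spans.precedes_iff {B B' : Finset ℤ} {a' b' : ℤ} (h : Spans B a b) (h' : Spans B' a' b') :
    Precedes B B' ↔ b < a' := by
  constructor
  · rintro ⟨k, k', hlt⟩
    rwa [h.max'_eq, h'.min'_eq] at hlt
  · intro hlt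
    have hB : B.Nonempty := ⟨a, h.1⟩
    have hB' : B'.Nonempty := ⟨a', h'.1⟩
    refine ⟨hB, hB', ?_⟩
    rwa [h.max'_eq, h'.min'_eq]

theorem Encodes.exists_spans (h : Encodes Δ F) (hF : IsCount F) (hn : 1 ≤ n) (ha : 1 ≤ a)
    (hg : Good n F a b) : ∃ B, Spans B a b ∧ Monochromatic Δ B ∧ #B = n + 1 := by
  have hab := hg.le_sub hF (by omega)
  obtain ⟨c, h1, h2, h3⟩ := (h.good_iff ha (by omega)).1 hg
  obtain ⟨B, k1, k2, k3⟩ := exists_subsuperset_card_eq (s := {a, b})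
    (t := {x ∈ Icc a b | Δ x = c}) (n := n + 1)
    (by
      intro x hx
      rw [mem_insert, mem_singleton] at hx
      rw [mem_filter, mem_Icc]
      rcases hx with rfl | rfl
      · exact ⟨by omega, h1⟩
      · exact ⟨by omega, h2⟩)
    (card_le_two.trans (by omega)) h3
  have haB : a ∈ B := k1 (by simp)
  refine ⟨B, ⟨haB, k1 (by simp), k2.trans (filter_subset _ _)⟩, ?_, k3⟩
  rw [Monochromatic, card_eq_one]
  refine ⟨c, eq_singleton_iff_unique_mem.2 ⟨mem_image.2 ⟨a, haB, h1⟩, ?_⟩⟩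
  intro d hd
  obtain ⟨x, hx, rfl⟩ := mem_image.1 hd
  exact (mem_filter.1 (k2 hx)).2

theorem Encodes.exists_good_of_monochromatic (h : Encodes Δ F) {B : Finset ℤ}
    (hB : B ⊆ Icc 1 N) (hm : Monochromatic Δ B) (hc : #B = n + 1) :
    ∃ a b, 1 ≤ a ∧ b ≤ N ∧ Spans B a b ∧ Good n F a b := by
  have hne : B.Nonempty := card_pos.1 (by omega)
  have h1 := B.min'_mem hne
  have h2 := B.max'_mem hne
  have h3 : B ⊆ Icc (B.min' hne) (B.max' hne) := fun x hx =>
    mem_Icc.2 ⟨B.min'_le x hx, B.le_max' x hx⟩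
  refine ⟨B.min' hne, B.max' hne, (mem_Icc.1 (hB h1)).1, (mem_Icc.1 (hB h2)).2, ⟨h1, h2, h3⟩, ?_⟩
  rw [h.good_iff (mem_Icc.1 (hB h1)).1 (B.min'_le _ h2)]
  obtain ⟨c, hc'⟩ := card_eq_one.1 hm
  have key : ∀ x ∈ B, Δ x = c := fun x hx => by
    rw [← mem_singleton, ← hc']
    exact mem_image_of_mem Δ hx
  refine ⟨c, key _ h1, key _ h2, ?_⟩
  rw [← hc]
  exact card_le_card fun x hx => mem_filter.2 ⟨h3 hx, key x hx⟩

end Colorings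

/-- The coloring encoded by `F` has in `[1, N]` three consecutive good pairs with nondecreasing
diameters. -/
def HasTriple (n : ℤ) (F : ℤ → ℤ) (N : ℤ) : Prop :=
  ∃ a₁ b₁ a₂ b₂ a₃ b₃, Good n F a₁ b₁ ∧ Good n F a₂ b₂ ∧ Good n F a₃ b₃ ∧ 1 ≤ a₁ ∧ b₁ < a₂ ∧
    b₂ < a₃ ∧ b₃ ≤ N ∧ b₁ - a₁ ≤ b₂ - a₂ ∧ b₂ - a₂ ≤ b₃ - a₃

theorem Encodes.exists_isSolution_iff {n N : ℕ} {Δ : ℤ → Fin 2} {F : ℤ → ℤ} (h : Encodes Δ F)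
    (hF : IsCount F) (hn : 1 ≤ n) :
    (∃ B, IsSolution ![n + 1, n + 1, n + 1] N Δ B) ↔ HasTriple n F N := by
  constructor
  · rintro ⟨B, hB⟩
    have key : ∀ i, ∃ a b, 1 ≤ a ∧ b ≤ (N : ℤ) ∧ Spans (B i) a b ∧ Good n F a b := fun i =>
      h.exists_good_of_monochromatic (hB.subset i) (hB.mono i) (by
        rw [hB.card i]
        fin_cases i <;> rfl)
    choose a b h1 h2 h3 h4 using key
    have hd := fun i j hij => hB.diam_le i j hij
    have hp := fun i j hij => ((h3 i).precedes_iff (h3 j)).1 (hB.precedes i j hij)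
    simp only [(h3 _).diam_eq] at hd
    exact ⟨a 0, b 0, a 1, b 1, a 2, b 2, h4 0, h4 1, h4 2, h1 0, hp 0 1 (by decide),
      hp 1 2 (by decide), h2 2, hd 0 1 (by decide), hd 1 2 (by decide)⟩
  · rintro ⟨a₁, b₁, a₂, b₂, a₃, b₃, g₁, g₂, g₃, h1, h2, h3, h4, h5, h6⟩
    have l₁ := g₁.le_sub hF (by omega)
    have l₂ := g₂.le_sub hF (by omega)
    have l₃ := g₃.le_sub hF (by omega)
    obtain ⟨B₁, s₁, m₁, c₁⟩ := h.exists_spans hF hn h1 g₁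
    obtain ⟨B₂, s₂, m₂, c₂⟩ := h.exists_spans hF hn (by omega) g₂
    obtain ⟨B₃, s₃, m₃, c₃⟩ := h.exists_spans hF hn (by omega) g₃
    refine ⟨![B₁, B₂, B₃], ?_, ?_, ?_, ?_, ?_⟩
    · simp only [Fin.forall_fin_succ]
      refine ⟨s₁.2.2.trans (Finset.Icc_subset_Icc ?_ ?_),
        s₂.2.2.trans (Finset.Icc_subset_Icc ?_ ?_),
        s₃.2.2.trans (Finset.Icc_subset_Icc ?_ ?_), fun i => i.elim0⟩ <;> omega
    · simp only [Fin.forall_fin_succ]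
      exact ⟨m₁, m₂, m₃, fun i => i.elim0⟩
    · simp only [Fin.forall_fin_succ]
      exact ⟨c₁, c₂, c₃, fun i => i.elim0⟩
    · intro i j hij
      fin_cases i <;> fin_cases j <;> first
        | exact absurd hij (by decide)
        | exact (s₁.precedes_iff s₂).2 h2
        | exact (s₂.precedes_iff s₃).2 h3
        | exact (s₁.precedes_iff s₃).2 (by omega)
    · have e₁ := s₁.diam_eq
      have e₂ := s₂.diam_eq
      have e₃ := s₃.diam_eq
      intro i j hij
      fin_cases i <;> fin_cases j <;> first
        | exact absurd hij (by decide)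
        | exact le_rfl
        | (change diam B₁ ≤ diam B₂; omega)
        | (change diam B₂ ≤ diam B₃; omega)
        | (change diam B₁ ≤ diam B₃; omega)

/-- The first 2n + 1 integers contain a good pair of diameter at most 2n, which precedes any two
long pairs. Shifting the coloring by 2n + 1 therefore yields `Avoids`. -/
theorem forces_of_avoids_false {n Q : ℕ} (hn : 1 ≤ n)
    (H : ∀ F, Avoids n (6 * n + 2 + Q) F → False) :
    Forces ![n + 1, n + 1, n + 1] 2 (8 * n + 3 + Q) := by
  intro Δ
  obtain ⟨F, hF, hΔ⟩ := exists_encodes Δ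
  rw [hΔ.exists_isSolution_iff hF hn]
  by_contra hT
  have hg : ∀ {a b : ℤ}, Good n (fun x => F (x + (2 * n + 1))) a b →
      Good n F (a + (2 * n + 1)) (b + (2 * n + 1)) := fun {a b} h => by
    unfold Good at h ⊢
    rw [show a + (2 * (n : ℤ) + 1) - 1 = a - 1 + (2 * n + 1) by ring,
      show b + (2 * (n : ℤ) + 1) - 1 = b - 1 + (2 * n + 1) by ring]
    dsimp only at h
    omega
  refine H (fun x => F (x + (2 * n + 1))) ⟨fun x => ?_, ?_, ?_⟩
  · have := hF (x + (2 * n + 1))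
    rwa [show x + (2 * (n : ℤ) + 1) - 1 = x - 1 + (2 * n + 1) by ring] at this
  · intro a₁ b₁ a₂ b₂ a₃ b₃ g₁ g₂ g₃ h1 h2 h3 h4 h5 h6
    exact hT ⟨_, _, _, _, _, _, hg g₁, hg g₂, hg g₃, by omega, by omega, by omega,
      by push_cast; omega, by omega, by omega⟩
  · intro a₂ b₂ a₃ b₃ g₂ g₃ h1 h2 h3 h4 h5
    obtain ⟨a₁, b₁, k1, k2, g₁⟩ :=
      hF.exists_good (n := n) (u := 0) (v := 2 * n + 1) (by omega) (by omega)
    exact hT ⟨_, _, _, _, _, _, g₁, hg g₂, hg g₃, by omega, by omega, by omega,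
      by push_cast; omega, by omega, by omega⟩

theorem not_forces {n N M : ℕ} {F : ℤ → ℤ} (hF : IsCount F) (hn : 1 ≤ n)
    (hT : ¬ HasTriple n F M) (hN : N ≤ M) : ¬ Forces ![n + 1, n + 1, n + 1] 2 N := by
  intro H
  have hΔ : Encodes (fun x => if F x = F (x - 1) then 0 else 1) F := fun x _ => by
    dsimp only
    split_ifs with h
    · simpa using h
    · simpa using (hF x).resolve_left h
  obtain ⟨a₁, b₁, a₂, b₂, a₃, b₃, g₁, g₂, g₃, h1, h2, h3, h4, h5⟩ :=
    (hΔ.exists_isSolution_iff hF hn).1 (H _)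
  exact hT ⟨a₁, b₁, a₂, b₂, a₃, b₃, g₁, g₂, g₃, h1, h2, h3, by omega, h5⟩

/-! ### The extremal coloring -/

section LowerBound

/-- The coloring `0 1ⁿ 0ⁿ 1ⁿ 0^q 1^(n-q) 0ⁿ 1^(2n+1+q) 0ⁿ`. -/
def blocks (n q x : ℤ) : ℤ :=
  if x ≤ 1 then 0 else if x ≤ n + 1 then x - 1 else if x ≤ 2 * n + 1 then n
  else if x ≤ 3 * n + 1 then x - n - 1 else if x ≤ 3 * n + 1 + q then 2 * n
  else if x ≤ 4 * n + 1 then x - n - 1 - q else if x ≤ 5 * n + 1 then 3 * n - q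
  else if x ≤ 7 * n + 2 + q then x - 2 * n - 1 - q else 5 * n + 1

variable {n q a b : ℤ}

theorem blocks_eq (hn : 1 ≤ n) (hq : 0 ≤ q) (hqn : 3 * q ≤ 2 * n) (x : ℤ) :
    (x ≤ 1 → blocks n q x = 0) ∧
    (1 ≤ x ∧ x ≤ n + 1 → blocks n q x = x - 1) ∧
    (n + 1 ≤ x ∧ x ≤ 2 * n + 1 → blocks n q x = n) ∧
    (2 * n + 1 ≤ x ∧ x ≤ 3 * n + 1 → blocks n q x = x - n - 1) ∧
    (3 * n + 1 ≤ x ∧ x ≤ 3 * n + 1 + q → blocks n q x = 2 * n) ∧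
    (3 * n + 1 + q ≤ x ∧ x ≤ 4 * n + 1 → blocks n q x = x - n - 1 - q) ∧
    (4 * n + 1 ≤ x ∧ x ≤ 5 * n + 1 → blocks n q x = 3 * n - q) ∧
    (5 * n + 1 ≤ x ∧ x ≤ 7 * n + 2 + q → blocks n q x = x - 2 * n - 1 - q) ∧
    (7 * n + 2 + q ≤ x → blocks n q x = 5 * n + 1) := by
  obtain ⟨y, hy⟩ : ∃ y, y = blocks n q x := ⟨_, rfl⟩
  rw [← hy]
  unfold blocks at hy
  split_ifs at hy <;> refine ⟨?_, ?_, ?_, ?_, ?_, ?_, ?_, ?_, ?_⟩ <;> intro h <;> omega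

theorem blocks_step (hn : 1 ≤ n) (hq : 0 ≤ q) (hqn : 3 * q ≤ 2 * n) (x : ℤ) :
    (blocks n q x = blocks n q (x - 1) ∧ (
      (x ≤ 1 ∧ blocks n q x = 0) ∨
      (n + 1 < x ∧ x ≤ 2 * n + 1 ∧ blocks n q x = n) ∨
      (3 * n + 1 < x ∧ x ≤ 3 * n + 1 + q ∧ blocks n q x = 2 * n) ∨
      (4 * n + 1 < x ∧ x ≤ 5 * n + 1 ∧ blocks n q x = 3 * n - q) ∨
      (7 * n + 2 + q < x ∧ blocks n q x = 5 * n + 1))) ∨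
    (blocks n q x = blocks n q (x - 1) + 1 ∧ (
      (1 < x ∧ x ≤ n + 1 ∧ blocks n q x = x - 1) ∨
      (2 * n + 1 < x ∧ x ≤ 3 * n + 1 ∧ blocks n q x = x - n - 1) ∨
      (3 * n + 1 + q < x ∧ x ≤ 4 * n + 1 ∧ blocks n q x = x - n - 1 - q) ∨
      (5 * n + 1 < x ∧ x ≤ 7 * n + 2 + q ∧ blocks n q x = x - 2 * n - 1 - q))) := by
  obtain ⟨h1, h2, h3, h4, h5, h6, h7, h8, h9⟩ := blocks_eq hn hq hqn x
  obtain ⟨k1, k2, k3, k4, k5, k6, k7, k8, k9⟩ := blocks_eq hn hq hqn (x - 1)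
  rcases le_or_gt x (1) with c1 | c1
  · have e := h1 (by omega)
    have e' := k1 (by omega)
    clear h1 h2 h3 h4 h5 h6 h7 h8 h9 k1 k2 k3 k4 k5 k6 k7 k8 k9
    omega
  rcases le_or_gt x (n + 1) with c2 | c2
  · have e := h2 (by omega)
    have e' := k2 (by omega)
    clear h1 h2 h3 h4 h5 h6 h7 h8 h9 k1 k2 k3 k4 k5 k6 k7 k8 k9
    omega
  rcases le_or_gt x (2 * n + 1) with c3 | c3
  · have e := h3 (by omega)
    have e' := k3 (by omega)
    clear h1 h2 h3 h4 h5 h6 h7 h8 h9 k1 k2 k3 k4 k5 k6 k7 k8 k9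
    omega
  rcases le_or_gt x (3 * n + 1) with c4 | c4
  · have e := h4 (by omega)
    have e' := k4 (by omega)
    clear h1 h2 h3 h4 h5 h6 h7 h8 h9 k1 k2 k3 k4 k5 k6 k7 k8 k9
    omega
  rcases le_or_gt x (3 * n + 1 + q) with c5 | c5
  · have e := h5 (by omega)
    have e' := k5 (by omega)
    clear h1 h2 h3 h4 h5 h6 h7 h8 h9 k1 k2 k3 k4 k5 k6 k7 k8 k9
    omega
  rcases le_or_gt x (4 * n + 1) with c6 | c6
  · have e := h6 (by omega)
    have e' := k6 (by omega)
    clear h1 h2 h3 h4 h5 h6 h7 h8 h9 k1 k2 k3 k4 k5 k6 k7 k8 k9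
    omega
  rcases le_or_gt x (5 * n + 1) with c7 | c7
  · have e := h7 (by omega)
    have e' := k7 (by omega)
    clear h1 h2 h3 h4 h5 h6 h7 h8 h9 k1 k2 k3 k4 k5 k6 k7 k8 k9
    omega
  rcases le_or_gt x (7 * n + 2 + q) with c8 | c8
  · have e := h8 (by omega)
    have e' := k8 (by omega)
    clear h1 h2 h3 h4 h5 h6 h7 h8 h9 k1 k2 k3 k4 k5 k6 k7 k8 k9
    omega
  have e := h9 (by omega)
  have e' := k9 (by omega)
  clear h1 h2 h3 h4 h5 h6 h7 h8 h9 k1 k2 k3 k4 k5 k6 k7 k8 k9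
  omega

theorem isCount_blocks (hn : 1 ≤ n) (hq : 0 ≤ q) (hqn : 3 * q ≤ 2 * n) : IsCount (blocks n q) :=
  fun x => (blocks_step hn hq hqn x).imp And.left And.left

theorem good_blocks_head (hn : 1 ≤ n) (hq : 0 ≤ q) (hqn : 3 * q ≤ 2 * n)
    (h : Good n (blocks n q) a b) (ha : 1 ≤ a) (ha' : a ≤ 2 * n + 1) :
    2 * n + 1 ≤ b ∧ 2 * n ≤ b - a := by
  have ka := blocks_step hn hq hqn a
  have kb := blocks_step hn hq hqn b
  rcases h with ⟨h1, h2, h3⟩ | ⟨h1, h2, h3⟩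
  · replace ka := (ka.resolve_left (by omega)).2
    replace kb := (kb.resolve_left (by omega)).2
    omega
  · replace ka := (ka.resolve_right (by omega)).2
    replace kb := (kb.resolve_right (by omega)).2
    omega

set_option maxHeartbeats 2000000 in
theorem good_blocks_tail (hn : 1 ≤ n) (hq : 0 ≤ q) (hqn : 3 * q ≤ 2 * n)
    (h : Good n (blocks n q) a b) (ha : 2 * n + 1 < a) (hb : b ≤ 8 * n + 2 + q) :
    (3 * n + 1 + q < b ∧ b ≤ 4 * n + 1 ∧ n + q ≤ b - a) ∨
    (3 * n + 1 < a ∧ 4 * n + 1 < b ∧ b ≤ 5 * n + 1 ∧ 2 * n - q ≤ b - a) ∨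
    (5 * n + 1 < a ∧ b ≤ 7 * n + 2 + q ∧ n ≤ b - a) ∨
    (3 * n + 1 + q < a ∧ a ≤ 4 * n + 1 ∧ 5 * n + 1 + q < b ∧ 2 * n ≤ b - a) ∨
    (a ≤ 3 * n + 1 ∧ 5 * n + 1 < b ∧ 2 * n + q ≤ b - a) ∨
    (3 * n + 1 < a ∧ a ≤ 5 * n + 1 ∧ 7 * n + 2 + q < b) := by
  have ka := blocks_step hn hq hqn a
  have kb := blocks_step hn hq hqn b
  rcases h with ⟨h1, h2, h3⟩ | ⟨h1, h2, h3⟩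
  · replace ka := (ka.resolve_left (by omega)).2
    replace kb := (kb.resolve_left (by omega)).2
    rcases ka with ka | ka | ka | ka <;> rcases kb with kb | kb | kb | kb <;> omega
  · replace ka := (ka.resolve_right (by omega)).2
    replace kb := (kb.resolve_right (by omega)).2
    rcases ka with ka | ka | ka | ka | ka <;> rcases kb with kb | kb | kb | kb | kb <;> omega

/-- Pairs starting in the first 2n + 1 positions have diameter at least 2n, and no two consecutive
pairs after them can. So all three pairs lie further right. The condition 3q ≤ 2n is what stops a
zero pair of diameter at least 2n - q from being followed by two pairs in the block of 2n + 1 + q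
ones. -/
theorem not_hasTriple_blocks (hn : 1 ≤ n) (hq : 0 ≤ q) (hqn : 3 * q ≤ 2 * n) :
    ¬ HasTriple n (blocks n q) (8 * n + 2 + q) := by
  rintro ⟨a₁, b₁, a₂, b₂, a₃, b₃, g₁, g₂, g₃, h1, h2, h3, h4, h5, h6⟩
  have hF := isCount_blocks hn hq hqn
  have l₁ := g₁.le_sub hF (by omega)
  have l₂ := g₂.le_sub hF (by omega)
  have l₃ := g₃.le_sub hF (by omega)
  have ht : 2 * n + 1 ≤ b₁ ∧ (2 * n ≤ b₁ - a₁ ∨ 2 * n + 1 < a₁) := by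
    rcases le_or_gt a₁ (2 * n + 1) with h | h
    · have := good_blocks_head hn hq hqn g₁ h1 h
      omega
    · omega
  have k₂ := good_blocks_tail hn hq hqn g₂ (by omega) (by omega)
  have k₃ := good_blocks_tail hn hq hqn g₃ (by omega) h4
  have key : b₂ - a₂ < 2 * n := by
    by_contra hd
    omega
  have k₁ := good_blocks_tail hn hq hqn g₁ (by omega) (by omega)
  omega

end LowerBound

/-! ### The exceptional words for m = 2 and m = 5 -/

section Words

/-- The number of ones among the first `x` letters of a word. -/
def wordCount (w : List Bool) (x : ℤ) : ℤ := ((w.take x.toNat).count true : ℕ)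

theorem isCount_wordCount (w : List Bool) : IsCount (wordCount w) := by
  intro x
  unfold wordCount
  rcases le_or_gt x 0 with hx | hx
  · left
    rw [Int.toNat_of_nonpos hx, Int.toNat_of_nonpos (by omega)]
  · obtain ⟨k, rfl⟩ : ∃ k : ℕ, x = k + 1 := ⟨(x - 1).toNat, by omega⟩
    rw [add_sub_cancel_right, Int.toNat_natCast, show ((k : ℤ) + 1).toNat = k + 1 by omega,
      List.take_add_one, List.count_append]
    rcases w[k]? with - | - | - <;> simp

/-- `Good` for the letters with indices `k` and `l` of a word. -/
def WordGood (n : ℕ) (w : List Bool) (k l : ℕ) : Prop :=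
  ((w.take (k + 1)).count true = (w.take k).count true + 1 ∧
    (w.take (l + 1)).count true = (w.take l).count true + 1 ∧
    n + 1 + (w.take k).count true ≤ (w.take (l + 1)).count true) ∨
  ((w.take (k + 1)).count true = (w.take k).count true ∧
    (w.take (l + 1)).count true = (w.take l).count true ∧
    n + 1 + k + (w.take (l + 1)).count true ≤ l + 1 + (w.take k).count true)

instance (n : ℕ) (w : List Bool) (k l : ℕ) : Decidable (WordGood n w k l) :=
  inferInstanceAs (Decidable (_ ∨ _))

variable {n N : ℕ} {w : List Bool} {lo hi : List ℕ}

theorem wordGood_of_good {k l : ℕ} (h : Good n (wordCount w) (k + 1) (l + 1)) :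
    WordGood n w k l := by
  unfold Good wordCount at h
  simp only [add_sub_cancel_right, Int.toNat_natCast,
    show ∀ m : ℕ, ((m : ℤ) + 1).toNat = m + 1 from fun m => by omega] at h
  unfold WordGood
  omega

/-- A test for the good pair of letters with indices `k` and `l` in a word of length `N`. The entry of
`lo` at `l` is a lower bound for the diameters of the good pairs that end at or before the letter
with index `l`, and the entry of `hi` at `k` is an upper bound for the diameters of the good pairs
that start at or after the letter with index `k`. -/
def WordBound (N : ℕ) (lo hi : List ℕ) (k l : ℕ) : Prop :=
  lo.getD l 0 ≤ l - k ∧ l - k ≤ hi.getD k 0 ∧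
    ¬(lo.getD (k - 1) 0 ≤ l - k ∧ l - k ≤ hi.getD (l + 1) 0 ∧ 0 < k ∧ l + 1 < N)

instance (N : ℕ) (lo hi : List ℕ) (k l : ℕ) : Decidable (WordBound N lo hi k l) :=
  inferInstanceAs (Decidable (_ ∧ _))

/-- The lists `lo` and `hi` are a certificate: the middle pair of a triple would have diameter
between the bound on its left and the bound on its right, which `WordBound` forbids. -/
theorem not_hasTriple_wordCount
    (hlo : ∀ i < N, ∀ j < N, i ≤ j → lo.getD j 0 ≤ lo.getD i 0)
    (hhi : ∀ i < N, ∀ j < N, i ≤ j → hi.getD j 0 ≤ hi.getD i 0)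
    (H : ∀ k < N, ∀ l < N, WordGood n w k l → WordBound N lo hi k l) :
    ¬ HasTriple n (wordCount w) N := by
  rintro ⟨a₁, b₁, a₂, b₂, a₃, b₃, g₁, g₂, g₃, h1, h2, h3, h4, h5, h6⟩
  have hF := isCount_wordCount w
  have l₁ := g₁.le_sub hF (by omega)
  have l₂ := g₂.le_sub hF (by omega)
  have l₃ := g₃.le_sub hF (by omega)
  have key : ∀ x : ℤ, 1 ≤ x → ∃ k : ℕ, x = k + 1 := fun x hx => ⟨(x - 1).toNat, by omega⟩
  obtain ⟨k₁, rfl⟩ := key a₁ h1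
  obtain ⟨k₂, rfl⟩ := key a₂ (by omega)
  obtain ⟨k₃, rfl⟩ := key a₃ (by omega)
  obtain ⟨m₁, rfl⟩ := key b₁ (by omega)
  obtain ⟨m₂, rfl⟩ := key b₂ (by omega)
  obtain ⟨m₃, rfl⟩ := key b₃ (by omega)
  have e₁ := H k₁ (by omega) m₁ (by omega) (wordGood_of_good g₁)
  have e₂ := H k₂ (by omega) m₂ (by omega) (wordGood_of_good g₂)
  have e₃ := H k₃ (by omega) m₃ (by omega) (wordGood_of_good g₃)
  unfold WordBound at e₁ e₂ e₃
  have := hlo m₁ (by omega) (k₂ - 1) (by omega) (by omega)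
  have := hhi (m₂ + 1) (by omega) k₃ (by omega) (by omega)
  omega

/-- The word `0 1 0 1 00 1 000 1`. -/
def wordOne : List Bool :=
  [false, true, false, true, false, false, true, false, false, false, true]

/-- The word `0 1⁴ 0⁴ 1⁴ 0⁸ 1⁴ 0² 1⁷ 0³`. -/
def wordFour : List Bool :=
  false :: (List.replicate 4 true ++ List.replicate 4 false ++ List.replicate 4 true ++
    List.replicate 8 false ++ List.replicate 4 true ++ List.replicate 2 false ++
    List.replicate 7 true ++ List.replicate 3 false)

theorem not_hasTriple_wordOne : ¬ HasTriple (1 : ℕ) (wordCount wordOne) (11 : ℕ) :=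
  -- The entry 99 exceeds every diameter: no good pair ends that early.
  not_hasTriple_wordCount (lo := [99, 99, 2, 2, 2, 1, 1, 1, 1, 1, 1])
    (hi := [9, 9, 7, 7, 5, 4, 4, 2, 1, 0, 0])
    (by decide +kernel) (by decide +kernel) (by decide +kernel)

theorem not_hasTriple_wordFour : ¬ HasTriple (4 : ℕ) (wordCount wordFour) (37 : ℕ) :=
  not_hasTriple_wordCount
    (lo := List.replicate 8 99 ++ List.replicate 9 8 ++ List.replicate 20 4)
    (hi := [36, 32, 31, 31, 31, 31, 30, 29, 28, 24, 23, 23, 23, 23, 22, 21, 20, 19, 18, 17, 16, 12,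
      11, 11, 11, 11, 6, 6, 5, 4, 0, 0, 0, 0, 0, 0, 0])
    (by decide +kernel) (by decide +kernel) (by decide +kernel)

end Words

/-! ### Assembling both bounds -/

theorem isRamseyNumber_of {n N : ℕ} {F : ℤ → ℤ} (h : Forces ![n + 1, n + 1, n + 1] 2 (N + 1))
    (hF : IsCount F) (hn : 1 ≤ n) (hT : ¬ HasTriple n F N) :
    IsRamseyNumber ![n + 1, n + 1, n + 1] 2 (N + 1) := by
  refine ⟨h, fun M hM => ?_⟩
  by_contra hlt
  exact not_forces hF hn hT (by omega) hM

theorem isRamseyNumber_three (m : ℕ) (hm : 2 ≤ m) :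
    IsRamseyNumber ![m, m, m] 2
      (8 * m - 5 + (2 * m - 2) / 3 + (if m = 2 ∨ m = 5 then 1 else 0)) := by
  obtain ⟨n, rfl⟩ : ∃ n, m = n + 1 := ⟨m - 1, by omega⟩
  by_cases h1 : n = 1
  · subst h1
    exact isRamseyNumber_of (n := 1) (N := 11)
      (forces_of_avoids_false (Q := 1) le_rfl fun F hA =>
        hA.false (Q := 1) (by norm_num) (by norm_num) (by norm_num) (by norm_num))
      (isCount_wordCount _) le_rfl not_hasTriple_wordOne
  by_cases h4 : n = 4
  · subst h4
    exact isRamseyNumber_of (n := 4) (N := 37)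
      (forces_of_avoids_false (Q := 3) (by norm_num) fun F hA =>
        hA.false (Q := 3) (by norm_num) (by norm_num) (by norm_num) (by norm_num))
      (isCount_wordCount _) (by norm_num) not_hasTriple_wordFour
  rw [if_neg (by omega), show 8 * (n + 1) - 5 + (2 * (n + 1) - 2) / 3 + 0 =
    8 * n + 2 + 2 * n / 3 + 1 by omega]
  refine isRamseyNumber_of ?_ (isCount_blocks (n := n) (q := (2 * n / 3 : ℕ)) (by omega) (by omega)
    (by omega)) (by omega) ?_
  · have := forces_of_avoids_false (n := n) (Q := 2 * n / 3) (by omega) fun F hA => ?_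
    · rwa [show 8 * n + 2 + 2 * n / 3 + 1 = 8 * n + 3 + 2 * n / 3 by omega]
    -- With n = 1 and n = 4 already treated, n = 2 is the only remaining case in which n + 1 ≤
    -- 2⌊2n/3⌋ fails.
    · by_cases h2 : n = 2
      · subst h2
        exact Avoids.false_of_two hA
      · exact hA.false (Q := (2 * n / 3 : ℕ)) (by omega) (by omega) (by omega) (by push_cast; omega)
  · have := not_hasTriple_blocks (n := n) (q := (2 * n / 3 : ℕ)) (by omega) (by omega) (by omega)
    exact_mod_cast this

end NondecreasingDiameter

theorem mainTheorem1 (m : ℕ) (hm : 2 ≤ m) :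
    NondecreasingDiameter.IsRamseyNumber ![m, m, m] 2
      (8 * m - 5 + (2 * m - 2) / 3 + (if m = 2 ∨ m = 5 then 1 else 0)) :=
  NondecreasingDiameter.isRamseyNumber_three m hm
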